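/- Let $N\ge 1$ and let $S\subset\mathbb{R}^{N+1}$ be a smooth hypersurface bounding a compact convex domain with non-empty interior, with everywhere positive definite second fundamental form. For $n\ge 1$ let $$\mathrm{Conf}_n(S)=\{q=(q_0,\dots,q_{n-1})\in S^{\times n} : q_j\neq q_{j+1}\ \forall j\in\mathbb{Z}/n\},\qquad \ell_n(q)=\sum_{j\in\mathbb{Z}/n}|q_{j+1}-q_j| ,$$ and, for $\epsilon>0$ and $a\in\mathbb{R}$, $$\mathrm{Conf}_n^{\epsilon}(S)=\Big\{q\in \mathrm{Conf}_n(S):\prod_{j\in\mathbb{Z}/n}|q_j-q_{j-1}|\ge\epsilon^n\Big\},\qquad \mathrm{Conf}_n^{\epsilon}(S)_{>a}=\{q\in\mathrm{Conf}_n^{\epsilon}(S):\ell_n(q)>a\}.$$ For $m\ge1$ let $\psi^m(q)=(q,\dots,q)$ ($m$ times) be the $m$-fold iteration map, which sends $\mathrm{Conf}_n(S)$ to $\mathrm{Conf}_{nm}(S)$. All homology is singular homology with coefficients in $\mathbb{Z}/2$. Let $q\in\mathrm{Conf}_n(S)$ be an isolated critical point of $\ell_n$ that is not a local maximum of $\ell_n$,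 let $c=\ell_n(q)$, let $b<c$, and let $\epsilon_0>0$ satisfy $\epsilon_0^n<\prod_{j}|q_j-q_{j-1}|$. Then for every integer $p\ge2$ there is $m=p^k$ with $k\ge0$ such that, for every $0<\epsilon\le\epsilon_0$ and in every degree, the homomorphism induced by $\psi^m$, $$H_*\big(\mathrm{Conf}_n^{\epsilon}(S)_{>c}\cup\{q\},\,\mathrm{Conf}_n^{\epsilon}(S)_{>c}\big)\longrightarrow H_*\big(\mathrm{Conf}_{nm}^{\epsilon}(S)_{>mb},\,\mathrm{Conf}_{nm}^{\epsilon}(S)_{>mc}\big),$$ from the local homology of $q$ (which by excision may be computed in $\mathrm{Conf}_n^{\epsilon}(S)$, as here), is zero. -/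

import Mathlib

open CategoryTheory CategoryTheory.Limits AlgebraicTopology
open scoped ContDiff Topology

noncomputable section

namespace Billiard

/-! ### Strictly convex hypersurfaces -/

/-- `S` is a smooth hypersurface of `ℝ^{N+1}` which is the boundary of a compact convex domain `K`
with non-empty interior, with everywhere positive definite second fundamental form: around each of
its points, `K` is a sublevel set `{f ≤ 0}` and `S` the level set `{f = 0}` of a smooth function
`f`, regular at the point, whose second derivative there is positive definite on the tangent
hyperplane `ker (df)`. (The second fundamental form with respect to the inner normal is the
restriction of the second derivative of `f` to the tangent hyperplane, divided by the norm of the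
gradient of `f`.) -/
def IsStrictlyConvexHypersurface {N : ℕ} (S : Set (EuclideanSpace ℝ (Fin (N + 1)))) : Prop :=
  ∃ K : Set (EuclideanSpace ℝ (Fin (N + 1))),
    IsCompact K ∧ Convex ℝ K ∧ (interior K).Nonempty ∧ S = frontier K ∧
    ∀ x ∈ S, ∃ (V : Set (EuclideanSpace ℝ (Fin (N + 1))))
      (f : EuclideanSpace ℝ (Fin (N + 1)) → ℝ),
      IsOpen V ∧ x ∈ V ∧ ContDiffOn ℝ ∞ f V ∧
      K ∩ V = {y | y ∈ V ∧ f y ≤ 0} ∧ S ∩ V = {y | y ∈ V ∧ f y = 0} ∧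
      fderiv ℝ f x ≠ 0 ∧
      ∀ v, v ≠ 0 → fderiv ℝ f x v = 0 → 0 < fderiv ℝ (fderiv ℝ f) x v v

/-- The tangent space of `S` at `x`: velocities at time `0` of smooth curves in `S` through `x`. -/
def tangentVectors {N : ℕ} (S : Set (EuclideanSpace ℝ (Fin (N + 1))))
    (x : EuclideanSpace ℝ (Fin (N + 1))) : Set (EuclideanSpace ℝ (Fin (N + 1))) :=
  {v | ∃ γ : ℝ → EuclideanSpace ℝ (Fin (N + 1)), ContDiffAt ℝ ∞ γ 0 ∧
    (∀ᶠ t in 𝓝 (0 : ℝ), γ t ∈ S) ∧ γ 0 = x ∧ HasDerivAt γ v 0}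

/-! ### Cyclic configuration spaces and the length functional -/

/-- The cyclic configuration space: `n`-tuples of points of `S`, indexed by `ℤ/n`, with
`q_j ≠ q_{j+1}` for all `j`. -/
def conf {N : ℕ} (S : Set (EuclideanSpace ℝ (Fin (N + 1)))) (n : ℕ) :
    Set (ZMod n → EuclideanSpace ℝ (Fin (N + 1))) :=
  {q | (∀ j, q j ∈ S) ∧ ∀ j, q j ≠ q (j + 1)}

/-- The length functional `∑_j |q_{j+1} - q_j|`. -/
def length {N n : ℕ} [NeZero n] (q : ZMod n → EuclideanSpace ℝ (Fin (N + 1))) : ℝ :=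
  ∑ j, ‖q (j + 1) - q j‖

/-- The product `∏_j |q_j - q_{j-1}|`. -/
def gapProd {N n : ℕ} [NeZero n] (q : ZMod n → EuclideanSpace ℝ (Fin (N + 1))) : ℝ :=
  ∏ j, ‖q j - q (j - 1)‖

/-- The subspace `Conf_n^ε(S)` of the cyclic configuration space: `∏_j |q_j - q_{j-1}| ≥ ε^n`. -/
def confEps {N : ℕ} (S : Set (EuclideanSpace ℝ (Fin (N + 1)))) (n : ℕ) [NeZero n] (ε : ℝ) :
    Set (ZMod n → EuclideanSpace ℝ (Fin (N + 1))) :=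
  {q | q ∈ conf S n ∧ ε ^ n ≤ gapProd q}

/-- The superlevel set `Conf_n^ε(S)_{>a}` of the length functional. -/
def superlevel {N : ℕ} (S : Set (EuclideanSpace ℝ (Fin (N + 1)))) (n : ℕ) [NeZero n] (ε a : ℝ) :
    Set (ZMod n → EuclideanSpace ℝ (Fin (N + 1))) :=
  {q | q ∈ confEps S n ε ∧ a < length q}

/-- `q` is a critical point of the length functional on the cyclic configuration space: its
differential vanishes on the tangent space of `S × ⋯ × S` at `q`. -/
def IsCritical {N : ℕ} (S : Set (EuclideanSpace ℝ (Fin (N + 1)))) {n : ℕ} [NeZero n]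
    (q : ZMod n → EuclideanSpace ℝ (Fin (N + 1))) : Prop :=
  q ∈ conf S n ∧
    ∀ v : ZMod n → EuclideanSpace ℝ (Fin (N + 1)), (∀ j, v j ∈ tangentVectors S (q j)) →
      fderiv ℝ length q v = 0

/-- `q` is an isolated critical point of the length functional. -/
def IsIsolatedCritical {N : ℕ} (S : Set (EuclideanSpace ℝ (Fin (N + 1)))) {n : ℕ} [NeZero n]
    (q : ZMod n → EuclideanSpace ℝ (Fin (N + 1))) : Prop :=
  IsCritical S q ∧ ∀ᶠ q' in 𝓝 q, IsCritical S q' → q' = q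

/-! ### The iteration map -/

/-- The `m`-fold iteration map `q ↦ (q, …, q)`; the `j`-th entry of the iterate is
`q_{j mod n}`. -/
def iter {N n : ℕ} (m : ℕ) (q : ZMod n → EuclideanSpace ℝ (Fin (N + 1))) :
    ZMod (n * m) → EuclideanSpace ℝ (Fin (N + 1)) :=
  fun j => q (ZMod.castHom (dvd_mul_right n m) (ZMod n) j)

theorem continuous_iter {N n : ℕ} (m : ℕ) :
    Continuous (iter m : (ZMod n → EuclideanSpace ℝ (Fin (N + 1))) → _) := by
  unfold iter
  fun_prop

theorem card_fiber {n m : ℕ} [NeZero n] [NeZero m] (i : ZMod n) :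
    (Finset.univ.filter
      (fun j : ZMod (n * m) => ZMod.castHom (dvd_mul_right n m) (ZMod n) j = i)).card = m := by
  set g := ZMod.castHom (dvd_mul_right n m) (ZMod n)
  have hsurj : Function.Surjective g := ZMod.castHom_surjective _
  have hconst : ∀ i : ZMod n, (Finset.univ.filter (fun j => g j = i)).card
      = (Finset.univ.filter (fun j => g j = 0)).card := by
    intro i
    obtain ⟨a, rfl⟩ := hsurj i
    refine Finset.card_bij' (fun j _ => j - a) (fun j _ => j + a) ?_ ?_ ?_ ?_ <;>
      simp +contextual
  have hsum := Finset.card_eq_sum_card_fiberwise (f := g) (s := Finset.univ)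
    (t := Finset.univ) (by simp)
  rw [Finset.sum_congr rfl (fun i _ => hconst i)] at hsum
  simp only [Finset.card_univ, ZMod.card, Finset.sum_const, smul_eq_mul] at hsum
  rw [hconst i]
  exact (Nat.eq_of_mul_eq_mul_left (NeZero.pos n) hsum).symm

theorem length_iter {N n m : ℕ} [NeZero n] [NeZero m]
    (q : ZMod n → EuclideanSpace ℝ (Fin (N + 1))) :
    length (iter m q) = m * length q := by
  unfold length iter
  simp only [map_add, map_one]
  rw [Finset.sum_comp (fun i : ZMod n => ‖q (i + 1) - q i‖), Finset.mul_sum]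
  rw [Finset.image_univ_of_surjective (ZMod.castHom_surjective _)]
  simp_rw [card_fiber, nsmul_eq_mul]

theorem gapProd_iter {N n m : ℕ} [NeZero n] [NeZero m]
    (q : ZMod n → EuclideanSpace ℝ (Fin (N + 1))) :
    gapProd (iter m q) = gapProd q ^ m := by
  unfold gapProd iter
  simp only [map_sub, map_one]
  rw [Finset.prod_comp (fun i : ZMod n => ‖q i - q (i - 1)‖), ← Finset.prod_pow]
  rw [Finset.image_univ_of_surjective (ZMod.castHom_surjective _)]
  simp_rw [card_fiber]

theorem iter_mem_confEps {N n m : ℕ} [NeZero n] [NeZero m]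
    {S : Set (EuclideanSpace ℝ (Fin (N + 1)))} {ε : ℝ} (hε : 0 < ε)
    {q : ZMod n → EuclideanSpace ℝ (Fin (N + 1))} (hq : q ∈ confEps S n ε) :
    iter m q ∈ confEps S (n * m) ε := by
  refine ⟨⟨fun j => hq.1.1 _, fun j => ?_⟩, ?_⟩
  · have := hq.1.2 (ZMod.castHom (dvd_mul_right n m) (ZMod n) j)
    simpa only [iter, map_add, map_one] using this
  · rw [gapProd_iter, pow_mul]
    exact pow_le_pow_left₀ (by positivity) hq.2 m

theorem iter_mapsTo_superlevel {N n : ℕ} (m : ℕ) [NeZero n] [NeZero m]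
    (S : Set (EuclideanSpace ℝ (Fin (N + 1)))) {ε : ℝ} (hε : 0 < ε) (a : ℝ) :
    Set.MapsTo (iter m) (superlevel S n ε a) (superlevel S (n * m) ε (m * a)) := by
  intro q hq
  refine ⟨iter_mem_confEps hε hq.1, ?_⟩
  rw [length_iter]
  exact mul_lt_mul_of_pos_left hq.2 (by exact_mod_cast NeZero.pos m)

theorem superlevel_anti {N : ℕ} (S : Set (EuclideanSpace ℝ (Fin (N + 1)))) (n : ℕ) [NeZero n]
    (ε : ℝ) {a a' : ℝ} (h : a ≤ a') : superlevel S n ε a' ⊆ superlevel S n ε a :=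
  fun _ hq => ⟨hq.1, lt_of_le_of_lt h hq.2⟩

theorem iter_mapsTo_local {N n : ℕ} (m : ℕ) [NeZero n] [NeZero m]
    (S : Set (EuclideanSpace ℝ (Fin (N + 1)))) {ε : ℝ} (hε : 0 < ε) {b : ℝ}
    {q : ZMod n → EuclideanSpace ℝ (Fin (N + 1))} (hq : q ∈ confEps S n ε) (hb : b < length q) :
    Set.MapsTo (iter m) (superlevel S n ε (length q) ∪ {q}) (superlevel S (n * m) ε (m * b)) := by
  rintro q' (h | h)
  · exact iter_mapsTo_superlevel m S hε b (superlevel_anti S n ε hb.le h)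
  · rw [Set.mem_singleton_iff.1 h]
    exact iter_mapsTo_superlevel m S hε b ⟨hq, hb⟩

theorem mem_confEps_of_le {N n : ℕ} [NeZero n] {S : Set (EuclideanSpace ℝ (Fin (N + 1)))}
    {q : ZMod n → EuclideanSpace ℝ (Fin (N + 1))} (hq : q ∈ conf S n) {ε ε₀ : ℝ} (hε : 0 < ε)
    (hle : ε ≤ ε₀) (h : ε₀ ^ n < gapProd q) : q ∈ confEps S n ε :=
  ⟨hq, (pow_le_pow_left₀ hε.le hle n).trans h.le⟩

/-! ### Relative singular homology with coefficients in `ℤ/2` -/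

/-- The singular chain complex functor with coefficients in `ℤ/2`. -/
abbrev singularChains : TopCat.{0} ⥤ ChainComplex (ModuleCat.{0} (ZMod 2)) ℕ :=
  (singularChainComplexFunctor (ModuleCat.{0} (ZMod 2))).obj (ModuleCat.of (ZMod 2) (ZMod 2))

/-- The continuous map between subspaces obtained by restricting a continuous map. -/
def restrictMap {T T' : Type} [TopologicalSpace T] [TopologicalSpace T'] {f : T → T'}
    (hf : Continuous f) {X : Set T} {X' : Set T'} (h : Set.MapsTo f X X') :
    TopCat.of X ⟶ TopCat.of X' :=
  TopCat.ofHom ⟨h.restrict f X X', hf.restrict h⟩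

/-- The relative singular chain complex `C_*(X, A; ℤ/2) = C_*(X; ℤ/2) / C_*(A; ℤ/2)` of
subspaces `A ⊆ X` of a topological space. -/
def relChains {T : Type} [TopologicalSpace T] {A X : Set T} (h : A ⊆ X) :
    ChainComplex (ModuleCat.{0} (ZMod 2)) ℕ :=
  cokernel (singularChains.map (restrictMap continuous_id (X := A) (X' := X) h))

/-- The relative singular homology `H_j(X, A; ℤ/2)`. -/
def relHomology {T : Type} [TopologicalSpace T] {A X : Set T} (h : A ⊆ X) (j : ℕ) :
    ModuleCat.{0} (ZMod 2) :=
  (relChains h).homology j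

/-- The chain map `C_*(X, A; ℤ/2) ⟶ C_*(X', A'; ℤ/2)` induced by a continuous map of pairs. -/
def relChainsMap {T T' : Type} [TopologicalSpace T] [TopologicalSpace T'] {f : T → T'}
    (hf : Continuous f) {A X : Set T} {A' X' : Set T'} (h : A ⊆ X) (h' : A' ⊆ X')
    (hX : Set.MapsTo f X X') (hA : Set.MapsTo f A A') : relChains h ⟶ relChains h' :=
  cokernel.map _ _ (singularChains.map (restrictMap hf hA)) (singularChains.map (restrictMap hf hX))
    (by rw [← Functor.map_comp, ← Functor.map_comp]; rfl)

/-- The homomorphism `H_j(X, A; ℤ/2) ⟶ H_j(X', A'; ℤ/2)` induced by a continuous map of pairs. -/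
def relHomologyMap {T T' : Type} [TopologicalSpace T] [TopologicalSpace T'] {f : T → T'}
    (hf : Continuous f) {A X : Set T} {A' X' : Set T'} (h : A ⊆ X) (h' : A' ⊆ X')
    (hX : Set.MapsTo f X X') (hA : Set.MapsTo f A A') (j : ℕ) :
    relHomology h j ⟶ relHomology h' j :=
  HomologicalComplex.homologyMap (relChainsMap hf h h' hX hA) j

/-! ### Local homology and the homomorphism induced by iteration -/

/-- The local homology of `q` in degree `j`, computed in `Conf_n^ε(S)`:
`H_j(Conf_n^ε(S)_{>c} ∪ {q}, Conf_n^ε(S)_{>c})` with `c` the length of `q`. -/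
abbrev localHomology {N n : ℕ} [NeZero n] (S : Set (EuclideanSpace ℝ (Fin (N + 1)))) (ε : ℝ)
    (q : ZMod n → EuclideanSpace ℝ (Fin (N + 1))) (j : ℕ) : ModuleCat.{0} (ZMod 2) :=
  relHomology (T := ZMod n → EuclideanSpace ℝ (Fin (N + 1)))
    (Set.subset_union_left : superlevel S n ε (length q) ⊆ superlevel S n ε (length q) ∪ {q}) j

/-- The homomorphism, induced by the `m`-fold iteration map, from the local homology of `q` to
`H_j(Conf_{nm}^ε(S)_{>mb}, Conf_{nm}^ε(S)_{>mc})`, with `c` the length of `q` and `b < c`. -/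
def iterHomologyMap {N n : ℕ} [NeZero n] (S : Set (EuclideanSpace ℝ (Fin (N + 1)))) {ε : ℝ}
    (hε : 0 < ε) {q : ZMod n → EuclideanSpace ℝ (Fin (N + 1))} (hq : q ∈ confEps S n ε)
    {b : ℝ} (hb : b < length q) (m : ℕ) [NeZero m] (j : ℕ) :
    localHomology S ε q j ⟶
      relHomology (superlevel_anti S (n * m) ε (mul_le_mul_of_nonneg_left hb.le m.cast_nonneg)) j :=
  relHomologyMap (continuous_iter m) _ _ (iter_mapsTo_local m S hε hq hb)
    (iter_mapsTo_superlevel m S hε (length q)) j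

end Billiard

end

noncomputable section

namespace Billiard

/-! ### Vanishing of maps on relative homology -/

/-! The proof rests on the principle that `m` blocks can be moved one at a time at a cost
independent of `m`. In a product of graph charts around `q`, isolatedness lets gradient ascent push
every nearby configuration longer than `c` above a level `c + δ`, without leaving the chart or
falling to `c` (`exists_deformation_of_isolated_critical`). As `q` is not a local maximum, there is
a nearby configuration `y'` longer than `c`, and all configurations in a small chart are longer than
`b`. Take `d > 0` so that the pushed configurations and `y'` are all at least `c + d` long.

After iteration, move the `m` blocks of a pushed configuration along a chart segment to `y'`, one
after the other. At each time at most one block is in transit and may lose up to `c + d - b`; the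
seams between blocks cost at most `4ΛR` in total. The length therefore stays at least `m(c + d) - (c
+ d - b) - 4ΛR`, which exceeds `mc` for large `m` (`lt_length_moveBlocks`). Hence near `q` the
iteration map, restricted to the configurations longer than `c`, contracts to a constant above level
`mc`.

Such a contraction annihilates the map on relative homology: the boundary of a local class dies
because the contracted map extends over `q`, and the absolute class produced by gluing is deformed
above level `mc` through straight segments in the chart, which stay above level `mb`
(`relHomologyMap_eq_zero_of_local_contraction`). -/

/-- A composition `S₁ ⟶ S₂ ⟶ S₃` of maps of short exact sequences of complexes is zero on the
homology of the third terms as soon as, up to homotopy, the first map extends to the middle term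
over the first term, and the second map compresses the middle term into the first term. -/
theorem homologyMap_comp_eq_zero {C : Type*} [Category* C] [Abelian C] {ι : Type*}
    {c : ComplexShape ι} {S₁ S₂ S₃ : ShortComplex (HomologicalComplex C c)}
    (h₁ : S₁.ShortExact) (h₂ : S₂.ShortExact) (φ : S₁ ⟶ S₂) (ψ : S₂ ⟶ S₃)
    (u : S₁.X₂ ⟶ S₂.X₁) (hu : Homotopy φ.τ₁ (S₁.f ≫ u))
    (w : S₂.X₂ ⟶ S₃.X₁) (hw : Homotopy ψ.τ₂ (w ≫ S₃.f)) (j : ι) :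
    HomologicalComplex.homologyMap (φ.τ₃ ≫ ψ.τ₃) j = 0 := by
  -- Classes coming from the middle term die, since `ψ` factors there through the first term up to
  -- homotopy.
  have hψ : HomologicalComplex.homologyMap S₂.g j ≫ HomologicalComplex.homologyMap ψ.τ₃ j = 0 := by
    rw [← HomologicalComplex.homologyMap_comp, ← ψ.comm₂₃, HomologicalComplex.homologyMap_comp,
      hw.homologyMap_eq, ← HomologicalComplex.homologyMap_comp, Category.assoc, S₃.zero, comp_zero,
      HomologicalComplex.homologyMap_zero]
  rw [HomologicalComplex.homologyMap_comp]
  -- It remains to lift the image under `φ` to the middle term. Its boundary factors through two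
  -- consecutive maps of the long exact sequence, hence vanishes; if `j` has no successor, every
  -- class lifts.
  by_cases hj : ∃ i, c.Rel j i
  · obtain ⟨i, hi⟩ := hj
    refine (h₂.homology_exact₃ j i hi).comp_eq_zero ?_ hψ
    have := HomologicalComplex.HomologySequence.δ_naturality φ h₁ h₂ j i hi
    dsimp only
    rw [← this, hu.homologyMap_eq, HomologicalComplex.homologyMap_comp,
      h₁.δ_comp_assoc, zero_comp]
  · have := h₂.epi_g
    have := HomologicalComplex.epi_homologyMap_of_epi_of_not_rel S₂.g j (by simpa using hj)
    rw [(cancel_epi _).1 (hψ.trans comp_zero.symm), comp_zero]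

/-- The sequence `C_*(A) ⟶ C_*(X) ⟶ C_*(X, A)` of singular chain complexes of a map `A ⟶ X`. -/
abbrev pairSequence {A X : TopCat.{0}} (i : A ⟶ X) :
    ShortComplex (ChainComplex (ModuleCat.{0} (ZMod 2)) ℕ) :=
  ShortComplex.mk (singularChains.map i) (cokernel.π (singularChains.map i)) (cokernel.condition _)

/-- Singular chains send injective maps to monomorphisms, so the cokernel sequence is also exact on
the left. -/
theorem pairSequence_shortExact {A X : TopCat.{0}} (i : A ⟶ X) [Mono i] :
    (pairSequence i).ShortExact where
  exact := ShortComplex.exact_cokernel _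
  mono_f := by dsimp; infer_instance
  epi_g := by dsimp; infer_instance

/-- The map of sequences of singular chain complexes induced by a commutative square. -/
abbrev pairSequenceMap {A X A' X' : TopCat.{0}} {i : A ⟶ X} {i' : A' ⟶ X'} (a : A ⟶ A')
    (x : X ⟶ X') (h : i ≫ x = a ≫ i') : pairSequence i ⟶ pairSequence i' where
  τ₁ := singularChains.map a
  τ₂ := singularChains.map x
  τ₃ := cokernel.map _ _ (singularChains.map a) (singularChains.map x)
    (by rw [← Functor.map_comp, ← Functor.map_comp, h])
  comm₁₂ := by dsimp; rw [← Functor.map_comp, ← Functor.map_comp, h]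
  comm₂₃ := by simp

theorem mono_restrictMap_id {T : Type} [TopologicalSpace T] {A X : Set T} (h : A ⊆ X) :
    Mono (restrictMap continuous_id (X := A) (X' := X) h) := by
  rw [TopCat.mono_iff_injective]
  exact Set.inclusion_injective h

open unitInterval in
/-- A map of pairs `(A ∪ {q}, A) ⟶ (X', A')` is zero on homology if it is homotopic on `A`, inside
`A'`, to a map which extends to `A ∪ {q}`, provided that the map on the double of `A ∪ {q}` along
`A` glued from the homotopy can be deformed into `A'`. -/
theorem relHomologyMap_eq_zero_of_homotopy {T T' : Type} [TopologicalSpace T] [TopologicalSpace T']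
    {f : T → T'} (hf : Continuous f) {A X : Set T} {A' X' : Set T'} (h : A ⊆ X) (h' : A' ⊆ X')
    (hX : Set.MapsTo f X X') (hA : Set.MapsTo f A A') (q : T) (hq : q ∉ A)
    (M : I × T × I → T')
    (hM : ContinuousOn M {z | z.2.1 ∈ X ∧ (z.2.1 = q → z.2.2 = 0 ∨ z.2.2 = 1)})
    (hMX : ∀ u, ∀ x ∈ X, ∀ t, (x = q → t = 0 ∨ t = 1) → M (u, x, t) ∈ X')
    (hMA : ∀ x ∈ X, ∀ t, (x = q → t = 1) → M (0, x, t) ∈ A')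
    (hM1 : ∀ x ∈ X, ∀ t, (x = q → t = 0 ∨ t = 1) → M (1, x, t) ∈ A')
    (hM0 : ∀ x ∈ X, M (0, x, 0) = f x) (j : ℕ) :
    relHomologyMap hf h h' hX hA j = 0 := by
  -- `E` is the cylinder over `X` with the open segment over `q` removed: `A × I` with two copies of
  -- `q`. `D` omits the copy at `t = 0`, so that `x ↦ (x, 0)` is a map of pairs `(X, A) → (E, D)`.
  let E : Set (T × I) := {z | z.1 ∈ X ∧ (z.1 = q → z.2 = 0 ∨ z.2 = 1)}
  let D : Set (T × I) := {z | z.1 ∈ X ∧ (z.1 = q → z.2 = 1)}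
  have hDE : D ⊆ E := fun z hz => ⟨hz.1, fun hzq => Or.inr (hz.2 hzq)⟩
  have hMc : Continuous fun z : I × E => M (z.1, z.2.1) :=
    hM.comp_continuous (by fun_prop) fun z => z.2.2
  have hne : ∀ x ∈ A, x ≠ q := fun x hx hxq => hq (hxq ▸ hx)
  have := mono_restrictMap_id h
  have := mono_restrictMap_id hDE
  have hi : Set.MapsTo (fun x : T => (x, (0 : I))) X E := fun x hx => ⟨hx, fun _ => Or.inl rfl⟩
  have hiA : Set.MapsTo (fun x : T => (x, (0 : I))) A D :=
    fun x hx => ⟨h hx, fun hxq => (hne x hx hxq).elim⟩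
  have hi1 : Set.MapsTo (fun x : T => (x, (1 : I))) X D := fun x hx => ⟨hx, fun _ => rfl⟩
  let φ : pairSequence (restrictMap continuous_id (X := A) (X' := X) h) ⟶
      pairSequence (restrictMap continuous_id (X := D) (X' := E) hDE) :=
    pairSequenceMap (restrictMap (by fun_prop) hiA) (restrictMap (by fun_prop) hi) rfl
  let F : TopCat.of E ⟶ TopCat.of X' :=
    TopCat.ofHom ⟨fun z => ⟨M (0, z.1), hMX 0 _ z.2.1 _ z.2.2⟩,
      (hMc.comp (f := fun z : E => ((0 : I), z)) (by fun_prop)).subtype_mk _⟩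
  let FD : TopCat.of D ⟶ TopCat.of A' :=
    TopCat.ofHom ⟨fun z => ⟨M (0, z.1), hMA _ z.2.1 _ z.2.2⟩,
      (hMc.comp (f := fun z : D => ((0 : I), (⟨z.1, hDE z.2⟩ : E))) (by fun_prop)).subtype_mk _⟩
  let ψ : pairSequence (restrictMap continuous_id (X := D) (X' := E) hDE) ⟶
      pairSequence (restrictMap continuous_id (X := A') (X' := X') h') :=
    pairSequenceMap FD F rfl
  let G : TopCat.of E ⟶ TopCat.of A' :=
    TopCat.ofHom ⟨fun z => ⟨M (1, z.1), hM1 _ z.2.1 _ z.2.2⟩,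
      (hMc.comp (f := fun z : E => ((1 : I), z)) (by fun_prop)).subtype_mk _⟩
  let i1 : TopCat.of X ⟶ TopCat.of D := restrictMap (by fun_prop) hi1
  -- Sliding `A` from `t = 0` to `t = 1` makes its inclusion into `D` extend over `q`.
  let HD : TopCat.Homotopy (restrictMap (by fun_prop) hiA : TopCat.of A ⟶ TopCat.of D)
      (restrictMap continuous_id (X := A) (X' := X) h ≫ i1) :=
    { toFun := fun z => ⟨(z.2.1, z.1), h z.2.2, fun hxq => (hne _ z.2.2 hxq).elim⟩
      continuous_toFun := by fun_prop
      map_zero_left := fun _ => rfl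
      map_one_left := fun _ => rfl }
  let HF : TopCat.Homotopy F (G ≫ restrictMap continuous_id (X := A') (X' := X') h') :=
    { toFun := fun z => ⟨M (z.1, z.2.1), hMX _ _ z.2.2.1 _ z.2.2.2⟩
      continuous_toFun := hMc.subtype_mk _
      map_zero_left := fun _ => rfl
      map_one_left := fun _ => rfl }
  have key := homologyMap_comp_eq_zero (pairSequence_shortExact _) (pairSequence_shortExact _) φ ψ
    (singularChains.map i1)
    ((HD.singularChainComplexFunctorObjMap _).trans (.ofEq (Functor.map_comp _ _ _)))
    (singularChains.map G)
    ((HF.singularChainComplexFunctorObjMap _).trans (.ofEq (Functor.map_comp _ _ _))) j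
  refine Eq.trans ?_ key
  refine congrArg (HomologicalComplex.homologyMap · j) ?_
  refine (cancel_epi (cokernel.π (singularChains.map
    (restrictMap continuous_id (X := A) (X' := X) h)))).1 ?_
  have hfF : restrictMap hf hX = restrictMap (by fun_prop) hi ≫ F :=
    TopCat.hom_ext (ContinuousMap.ext fun x => Subtype.ext (hM0 _ x.2).symm)
  have hφψ : (pairSequence _).g ≫ φ.τ₃ ≫ ψ.τ₃ = φ.τ₂ ≫ ψ.τ₂ ≫ (pairSequence _).g := by
    rw [← φ.comm₂₃_assoc, ← ψ.comm₂₃]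
  refine (cokernel.π_desc _ _ _).trans (Eq.trans ?_ hφψ.symm)
  rw [hfF, Functor.map_comp, Category.assoc]

open unitInterval in
/-- A map of pairs `(A ∪ {q}, A) ⟶ (X', A')` is zero on homology if near `q` it lifts to a convex
subset `W` over `X'`, and the lift contracts on `A` inside the preimage of `A'`. -/
theorem relHomologyMap_eq_zero_of_local_contraction {T T' : Type} [MetricSpace T]
    [TopologicalSpace T'] {f : T → T'} (hf : Continuous f) {A X : Set T} {A' X' : Set T'}
    (h : A ⊆ X) (h' : A' ⊆ X') (hX : Set.MapsTo f X X') (hA : Set.MapsTo f A A') (q : T)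
    (hq : q ∉ A) (hXq : X = A ∪ {q}) {F : Type*} [NormedAddCommGroup F] [NormedSpace ℝ F]
    {W : Set F} (hW : Convex ℝ W) {κ : F → T'} (hκ : ContinuousOn κ W) (hκX : Set.MapsTo κ W X')
    {V : Set T} (hV : V ∈ 𝓝 q) {τ : T → F} (hτ : ContinuousOn τ (X ∩ V))
    (hτW : Set.MapsTo τ (X ∩ V) W) (hκτ : ∀ x ∈ X ∩ V, κ (τ x) = f x)
    {Γ : T × I → F} (hΓ : ContinuousOn Γ {z | z.1 ∈ A ∩ V}) (hΓW : ∀ x ∈ A ∩ V, ∀ t, Γ (x, t) ∈ W)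
    (hΓA : ∀ x ∈ A ∩ V, ∀ t, κ (Γ (x, t)) ∈ A') (hΓ0 : ∀ x ∈ A ∩ V, Γ (x, 0) = τ x)
    {w : F} (hw : w ∈ W) (hwA : κ w ∈ A') (hΓ1 : ∀ x ∈ A ∩ V, Γ (x, 1) = w) (j : ℕ) :
    relHomologyMap hf h h' hX hA j = 0 := by
  classical
  have hqX : q ∈ X := hXq ▸ Or.inr rfl
  have hXA : ∀ x ∈ X, x ≠ q → x ∈ A := fun x hx hne => by
    rw [hXq] at hx; exact hx.resolve_right hne
  obtain ⟨r, hr, hrV⟩ : ∃ r > 0, ∀ x, dist x q < 3 * r → x ∈ V := by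
    obtain ⟨ε, hε, hεV⟩ := Metric.mem_nhds_iff.1 hV
    exact ⟨ε / 3, by positivity, fun x hx => hεV (by rw [Metric.mem_ball]; linarith)⟩
  -- The contraction parameter is cut off in both variables: it vanishes for `dist x q ≥ 2r`, so the
  -- homotopy can be glued to `f` there, and it is locally constant in `t` near the two ends close
  -- to `q`, where `Γ` itself has no limit prescribed.
  let par : T → I → I := fun x t =>
    Set.projIcc (0 : ℝ) 1 zero_le_one (2 - dist x q / r) *
      Set.projIcc (0 : ℝ) 1 zero_le_one (3 * (t : ℝ) - 1)
  have hpar : Continuous fun z : T × I => par z.1 z.2 := by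
    have : Continuous (Set.projIcc (0 : ℝ) 1 zero_le_one) := continuous_projIcc
    fun_prop
  have hpar0 : ∀ x t, 2 * r ≤ dist x q → par x t = 0 := fun x t hx => by
    have : 2 - dist x q / r ≤ 0 := by rw [sub_nonpos, le_div_iff₀ hr]; exact hx
    simp only [par, Set.projIcc_of_le_left zero_le_one this]
    exact zero_mul _
  have hpart0 : ∀ x (t : I), (t : ℝ) ≤ 1 / 3 → par x t = 0 := fun x t ht => by
    have : 3 * (t : ℝ) - 1 ≤ 0 := by linarith
    simp only [par, Set.projIcc_of_le_left zero_le_one this]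
    exact mul_zero _
  have hpart1 : ∀ x (t : I), dist x q ≤ r → 2 / 3 ≤ (t : ℝ) → par x t = 1 := fun x t hx ht => by
    have h1 : 1 ≤ 3 * (t : ℝ) - 1 := by linarith
    have h2 : 1 ≤ 2 - dist x q / r := by
      have : dist x q / r ≤ 1 := by rw [div_le_iff₀ hr]; linarith
      linarith
    simp only [par, Set.projIcc_of_right_le zero_le_one h1, Set.projIcc_of_right_le zero_le_one h2]
    exact mul_one _
  -- The two copies of `q` receive different values: the lift `τ q` at `t = 0` and the end `w` of
  -- the contraction at `t = 1`.
  let g : T → I → F := fun x t =>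
    if x = q then (if t = 0 then τ q else w) else Γ (x, par x t)
  let E : Set (T × I) := {z | z.1 ∈ X ∧ (z.1 = q → z.2 = 0 ∨ z.2 = 1)}
  let B : Set T := {x | dist x q < 3 * r}
  have hBopen : IsOpen B := isOpen_lt (by fun_prop) continuous_const
  have hgW : ∀ x ∈ X, x ∈ B → ∀ t, g x t ∈ W := by
    intro x hx hxB t
    simp only [g]
    split_ifs with h1 h2
    · exact hτW ⟨hqX, mem_of_mem_nhds hV⟩
    · exact hw
    · exact hΓW x ⟨hXA x hx h1, hrV x hxB⟩ _
  have hg0 : ∀ x ∈ X, x ∈ B → ∀ t : I, (x = q → t = 0 ∨ t = 1) → (t : ℝ) ≤ 1 / 3 →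
      g x t = τ x := by
    intro x hx hxB t hxt ht
    simp only [g]
    split_ifs with h1 h2
    · rw [h1]
    · rcases hxt h1 with h3 | h3
      · exact absurd h3 h2
      · rw [h3] at ht; norm_num at ht
    · rw [hpart0 x t ht, hΓ0 x ⟨hXA x hx h1, hrV x hxB⟩]
  have hg1 : ∀ x ∈ X, x ∈ B → dist x q ≤ r → ∀ t : I, 2 / 3 ≤ (t : ℝ) → g x t = w := by
    intro x hx hxB hxr t ht
    simp only [g]
    split_ifs with h1 h2
    · rw [h2] at ht; norm_num at ht
    · rfl
    · rw [hpart1 x t hxr ht, hΓ1 x ⟨hXA x hx h1, hrV x hxB⟩]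
  have hg : ContinuousOn (fun z : T × I => g z.1 z.2) (E ∩ {z | z.1 ∈ B}) := by
    rintro ⟨x, t⟩ ⟨hE, hxB⟩
    by_cases hxq : x = q
    · subst hxq
      rcases hE.2 rfl with (h0 : t = 0) | (h0 : t = 1)
      · have ht : {z : T × I | (z.2 : ℝ) < 1 / 3} ∈ 𝓝 (x, t) :=
          (isOpen_lt (by fun_prop) continuous_const).mem_nhds (by simp [h0])
        have hc : ContinuousWithinAt (fun z : T × I => τ z.1) (E ∩ {z | z.1 ∈ B}) (x, t) :=
          ContinuousWithinAt.comp (g := τ) (t := X ∩ V) (x := (x, t)) (f := Prod.fst)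
            (hτ x ⟨hqX, mem_of_mem_nhds hV⟩) continuousWithinAt_fst
            fun z hz => ⟨hz.1.1, hrV _ hz.2⟩
        refine hc.congr_of_eventuallyEq ?_ (hg0 x hE.1 hxB t hE.2 (by simp [h0]))
        filter_upwards [self_mem_nhdsWithin, mem_nhdsWithin_of_mem_nhds ht] with z hz hz'
        exact hg0 _ hz.1.1 hz.2 _ hz.1.2 hz'.le
      · have ht : {z : T × I | 2 / 3 < (z.2 : ℝ)} ∈ 𝓝 (x, t) :=
          (isOpen_lt continuous_const (by fun_prop)).mem_nhds (by simp [h0]; norm_num)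
        have hr' : {z : T × I | dist z.1 x < r} ∈ 𝓝 (x, t) :=
          (isOpen_lt (by fun_prop) continuous_const).mem_nhds (by simpa using hr)
        refine (continuousWithinAt_const (b := w)).congr_of_eventuallyEq ?_
          (hg1 x hE.1 hxB (by simpa using hr.le) t (by simp [h0]; norm_num))
        filter_upwards [self_mem_nhdsWithin, mem_nhdsWithin_of_mem_nhds ht,
          mem_nhdsWithin_of_mem_nhds hr'] with z hz hz' hz''
        exact hg1 _ hz.1.1 hz.2 hz''.le _ hz'.le
    · have hne : {z : T × I | z.1 ≠ q} ∈ 𝓝 (x, t) :=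
        (isOpen_ne_fun continuous_fst continuous_const).mem_nhds hxq
      rw [← continuousWithinAt_inter hne]
      have hc : ContinuousWithinAt (fun z : T × I => Γ (z.1, par z.1 z.2))
          (E ∩ {z | z.1 ∈ B} ∩ {z | z.1 ≠ q}) (x, t) :=
        (hΓ (x, par x t) ⟨hXA x hE.1 hxq, hrV x hxB⟩).comp (x := (x, t))
          (f := fun z : T × I => (z.1, par z.1 z.2))
          (continuous_fst.prodMk hpar).continuousWithinAt
          fun z hz => ⟨hXA _ hz.1.1.1 hz.2, hrV _ hz.1.2⟩
      exact hc.congr (fun z hz => if_neg hz.2) (if_neg hxq)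
  -- Convexity of `W` allows a straight deformation of each slice `t` to the slice `1`, which lies
  -- over `A'`. Only intermediate times `u` may leave the preimage of `A'`.
  let M : I × T × I → T' := fun z =>
    if z.2.1 ∈ B then κ (AffineMap.lineMap (g z.2.1 z.2.2) (g z.2.1 1) (z.1 : ℝ)) else f z.2.1
  have hMB : ∀ u x t, x ∈ B → M (u, x, t) = κ (AffineMap.lineMap (g x t) (g x 1) (u : ℝ)) :=
    fun u x t hx => if_pos hx
  have hlW : ∀ x ∈ X, x ∈ B → ∀ (u t : I), AffineMap.lineMap (g x t) (g x 1) (u : ℝ) ∈ W :=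
    fun x hx hxB u t => hW.lineMap_mem (hgW x hx hxB t) (hgW x hx hxB 1) u.2
  have hfar : ∀ x ∈ X, x ∈ B → 2 * r ≤ dist x q → ∀ t, g x t = τ x := by
    intro x hx hxB hxr t
    have hxq : x ≠ q := by
      rintro rfl
      rw [dist_self] at hxr
      linarith
    simp only [g, if_neg hxq]
    rw [hpar0 x t hxr, hΓ0 x ⟨hXA x hx hxq, hrV x hxB⟩]
  have hMfar : ∀ x ∈ X, 2 * r ≤ dist x q → ∀ u t, M (u, x, t) = f x := by
    intro x hx hxr u t
    by_cases hxB : x ∈ B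
    · rw [hMB u x t hxB, hfar x hx hxB hxr, hfar x hx hxB hxr, AffineMap.lineMap_same,
        AffineMap.const_apply, hκτ x ⟨hx, hrV x hxB⟩]
    · exact if_neg hxB
  have hgA : ∀ x ∈ X, x ∈ B → ∀ t : I, (x = q → t = 1) → κ (g x t) ∈ A' := by
    intro x hx hxB t hxt
    by_cases hxq : x = q
    · rw [hxt hxq, hg1 x hx hxB (by simp [hxq, hr.le]) 1 (by norm_num)]
      exact hwA
    · simp only [g, if_neg hxq]
      exact hΓA x ⟨hXA x hx hxq, hrV x hxB⟩ _
  have hfA : ∀ x ∈ X, x ∉ B → f x ∈ A' := fun x hx hxB =>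
    hA (hXA x hx fun hxq => hxB (by simp [B, hxq, hr]))
  refine relHomologyMap_eq_zero_of_homotopy hf h h' hX hA q hq M ?_ ?_ ?_ ?_ ?_ j
  · rintro ⟨u, x, t⟩ ⟨hx, hxt⟩
    by_cases hxB : x ∈ B
    · have hnhds : {z : I × T × I | z.2.1 ∈ B} ∈ 𝓝 (u, x, t) :=
        (hBopen.preimage (by fun_prop)).mem_nhds hxB
      rw [← continuousWithinAt_inter hnhds]
      have hg' : ContinuousWithinAt (fun z : I × T × I => g z.2.1 z.2.2)
          ({z | z.2.1 ∈ X ∧ (z.2.1 = q → z.2.2 = 0 ∨ z.2.2 = 1)} ∩ {z | z.2.1 ∈ B}) (u, x, t) :=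
        ContinuousWithinAt.comp (g := fun z : T × I => g z.1 z.2) (x := (u, x, t)) (f := Prod.snd)
          (hg (x, t) ⟨⟨hx, hxt⟩, hxB⟩) continuousWithinAt_snd fun z hz => hz
      have hg1' : ContinuousWithinAt (fun z : I × T × I => g z.2.1 1)
          ({z | z.2.1 ∈ X ∧ (z.2.1 = q → z.2.2 = 0 ∨ z.2.2 = 1)} ∩ {z | z.2.1 ∈ B}) (u, x, t) :=
        (hg (x, 1) ⟨⟨hx, fun _ => Or.inr rfl⟩, hxB⟩).comp (x := (u, x, t))
          (f := fun z : I × T × I => (z.2.1, (1 : I)))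
          (by fun_prop) fun z hz => ⟨⟨hz.1.1, fun _ => Or.inr rfl⟩, hz.2⟩
      have hl : ContinuousWithinAt
          (fun z : I × T × I => AffineMap.lineMap (g z.2.1 z.2.2) (g z.2.1 1) (z.1 : ℝ))
          ({z | z.2.1 ∈ X ∧ (z.2.1 = q → z.2.2 = 0 ∨ z.2.2 = 1)} ∩ {z | z.2.1 ∈ B}) (u, x, t) := by
        simp only [AffineMap.lineMap_apply_module]
        have hu : ContinuousWithinAt (fun z : I × T × I => (z.1 : ℝ))
          ({z | z.2.1 ∈ X ∧ (z.2.1 = q → z.2.2 = 0 ∨ z.2.2 = 1)} ∩ {z | z.2.1 ∈ B}) (u, x, t) := by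
          fun_prop
        exact ((continuousWithinAt_const.sub hu).smul hg').add (hu.smul hg1')
      have hc := (hκ _ (hlW x hx hxB u t)).comp (x := (u, x, t)) hl
        fun z hz => hlW _ hz.1.1 hz.2 _ _
      exact hc.congr (fun z hz => hMB _ _ _ hz.2) (hMB _ _ _ hxB)
    · have hnhds : {z : I × T × I | 2 * r < dist z.2.1 q} ∈ 𝓝 (u, x, t) :=
        (isOpen_lt continuous_const (by fun_prop)).mem_nhds (by
          have : 3 * r ≤ dist x q := not_lt.1 hxB
          change 2 * r < dist x q
          linarith)
      have hc : ContinuousWithinAt (fun z : I × T × I => f z.2.1)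
          {z | z.2.1 ∈ X ∧ (z.2.1 = q → z.2.2 = 0 ∨ z.2.2 = 1)} (u, x, t) := by fun_prop
      refine hc.congr_of_eventuallyEq ?_ (if_neg hxB)
      filter_upwards [self_mem_nhdsWithin, mem_nhdsWithin_of_mem_nhds hnhds] with z hz hz'
      exact hMfar _ hz.1 hz'.le _ _
  · intro u x hx t _
    by_cases hxB : x ∈ B
    · rw [hMB u x t hxB]
      exact hκX (hlW x hx hxB u t)
    · rw [show M (u, x, t) = f x from if_neg hxB]
      exact hX hx
  · intro x hx t hxt
    by_cases hxB : x ∈ B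
    · rw [hMB 0 x t hxB, Set.Icc.coe_zero, AffineMap.lineMap_apply_zero]
      exact hgA x hx hxB t hxt
    · rw [show M (0, x, t) = f x from if_neg hxB]
      exact hfA x hx hxB
  · intro x hx t _
    by_cases hxB : x ∈ B
    · rw [hMB 1 x t hxB, Set.Icc.coe_one, AffineMap.lineMap_apply_one]
      exact hgA x hx hxB 1 fun _ => rfl
    · rw [show M (1, x, t) = f x from if_neg hxB]
      exact hfA x hx hxB
  · intro x hx
    by_cases hxB : x ∈ B
    · rw [hMB 0 x 0 hxB, Set.Icc.coe_zero, AffineMap.lineMap_apply_zero,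
        hg0 x hx hxB 0 (fun _ => Or.inl rfl) (by norm_num), hκτ x ⟨hx, hrV x hxB⟩]
    · exact if_neg hxB

/-! ### Gradient ascent -/

open unitInterval in
/-- If a homotopy `h` starting at the identity does not decrease `L`, and the iterates of its end
eventually bring every point above the level `d`, then the space can be deformed above the level `d`
without decreasing `L`. -/
theorem exists_deformation_of_iterate {Q : Type*} [MetricSpace Q] {h : Q × I → Q}
    (hh : Continuous h) (h0 : ∀ y, h (y, 0) = y) {L : Q → ℝ} (hL : Continuous L)
    (hmono : ∀ y s, L y ≤ L (h (y, s))) {d : ℝ}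
    (hd : ∀ y, ∃ k : ℕ, d < L ((fun y => h (y, 1))^[k] y)) :
    ∃ Φ : Q × I → Q, Continuous Φ ∧ (∀ y, Φ (y, 0) = y) ∧ (∀ y t, L y ≤ L (Φ (y, t))) ∧
      ∀ y, d ≤ L (Φ (y, 1)) := by
  let cl : ℝ → I := Set.projIcc (0 : ℝ) 1 zero_le_one
  have hcl : Continuous cl := continuous_projIcc
  -- `Ψ k` runs the first `k` copies of `h` one after another in unit time intervals; stages not yet
  -- reached at the given time are the identity.
  let Ψ : ℕ → Q × ℝ → Q := fun k => Nat.rec (fun z => z.1) (fun k Ψk z => h (Ψk z, cl (z.2 - k))) k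
  have hΨs : ∀ k z, Ψ (k + 1) z = h (Ψ k z, cl (z.2 - k)) := fun _ _ => rfl
  have hΨc : ∀ k, Continuous (Ψ k) := by
    intro k
    induction k with
    | zero => exact continuous_fst
    | succ k ih =>
      exact hh.comp (f := fun z : Q × ℝ => (Ψ k z, cl (z.2 - k))) (by fun_prop)
  have hΨL : ∀ k l, k ≤ l → ∀ z, L (Ψ k z) ≤ L (Ψ l z) := fun k l hkl z =>
    monotone_nat_of_le_succ (f := fun k => L (Ψ k z)) (fun k => hmono _ _) hkl
  have hΨstab : ∀ k l : ℕ, k ≤ l → ∀ z : Q × ℝ, z.2 ≤ k → Ψ l z = Ψ k z := by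
    intro k l hkl z hz
    induction l, hkl using Nat.le_induction with
    | base => rfl
    | succ l hkl ih =>
      have : z.2 - l ≤ 0 := by
        have : (k : ℝ) ≤ l := by exact_mod_cast hkl
        linarith
      rw [hΨs, ih, show cl (z.2 - l) = 0 from Set.projIcc_of_le_left _ this, h0]
  have hΨiter : ∀ (k : ℕ) (z : Q × ℝ), (k : ℝ) ≤ z.2 → Ψ k z = (fun y => h (y, 1))^[k] z.1 := by
    intro k z hz
    induction k with
    | zero => rfl
    | succ k ih =>
      push_cast at hz
      have : 1 ≤ z.2 - k := by linarith
      rw [hΨs, ih (by linarith), show cl (z.2 - k) = 1 from Set.projIcc_of_right_le _ this,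
        Function.iterate_succ_apply']
  -- All stages run together. Near a given time this agrees with a single `Ψ k`, whence the
  -- continuity.
  let P : Q × ℝ → Q := fun z => Ψ ⌈z.2⌉₊ z
  have hPc : Continuous P := by
    rw [continuous_iff_continuousAt]
    intro z
    refine (hΨc (⌈z.2⌉₊ + 1)).continuousAt.congr ?_
    have : {w : Q × ℝ | w.2 < ⌈z.2⌉₊ + 1} ∈ 𝓝 z :=
      (isOpen_lt continuous_snd continuous_const).mem_nhds
        ((Nat.le_ceil z.2).trans_lt (lt_add_one _))
    filter_upwards [this] with w hw
    have hw' : ⌈w.2⌉₊ ≤ ⌈z.2⌉₊ + 1 := Nat.ceil_le.2 (by push_cast; exact hw.le)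
    exact hΨstab _ _ hw' _ (Nat.le_ceil _)
  -- The number of stages needed varies with the point. Admissible stopping times form an upward
  -- closed, hence convex, set and are locally constant choices, so a continuous stopping time can
  -- be patched together.
  obtain ⟨T, hT⟩ := exists_continuous_forall_mem_convex_of_local_const
    (t := fun y : Q => {T : ℝ | 0 ≤ T ∧ ∀ s, T ≤ s → d ≤ L (P (y, s))}) (by
      intro y a ha b hb u v hu hv huv
      have hab : min a b ≤ u • a + v • b := by
        have h1 : u * min a b ≤ u * a := mul_le_mul_of_nonneg_left (min_le_left _ _) hu
        have h2 : v * min a b ≤ v * b := mul_le_mul_of_nonneg_left (min_le_right _ _) hv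
        calc min a b = u * min a b + v * min a b := by rw [← add_mul, huv, one_mul]
          _ ≤ u • a + v • b := add_le_add h1 h2
      refine ⟨(le_min ha.1 hb.1).trans hab, fun s hs => ?_⟩
      rcases min_choice a b with hm | hm
      · exact ha.2 s (by rw [← hm]; exact hab.trans hs)
      · exact hb.2 s (by rw [← hm]; exact hab.trans hs)) (by
      intro y
      obtain ⟨k, hk⟩ := hd y
      refine ⟨k, ?_⟩
      have hc : Continuous fun y => L (Ψ k (y, (k : ℝ))) :=
        hL.comp ((hΨc k).comp (by fun_prop))
      have hk' : d < L (Ψ k (y, (k : ℝ))) := by rw [hΨiter k _ le_rfl]; exact hk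
      filter_upwards [hc.continuousAt.eventually (lt_mem_nhds hk')] with x hx
      refine ⟨k.cast_nonneg, fun s hs => ?_⟩
      have hks : k ≤ ⌈s⌉₊ := by exact_mod_cast hs.trans (Nat.le_ceil s)
      refine le_trans ?_ (hΨL k _ hks (x, s))
      rw [hΨiter k (x, s) hs]
      rw [hΨiter k _ le_rfl] at hx
      exact hx.le)
  refine ⟨fun z => P (z.1, z.2 * T z.1), ?_, fun y => ?_, fun y t => ?_, fun y => ?_⟩
  · exact hPc.comp (by fun_prop)
  · simp [P, Ψ]
  · exact hΨL 0 _ (Nat.zero_le _) (y, t * T y)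
  · exact (hT y).2 _ (by simp)

section GradientAscent

variable {H : Type*} [NormedAddCommGroup H] [InnerProductSpace ℝ H] [CompleteSpace H]

theorem fderiv_gradient_self {L : H → ℝ} (y : H) :
    fderiv ℝ L y (gradient L y) = ‖gradient L y‖ ^ 2 := by
  rw [← real_inner_self_eq_norm_sq]
  exact (InnerProductSpace.toDual_symm_apply (x := gradient L y) (y := fderiv ℝ L y)).symm

theorem norm_gradient (L : H → ℝ) (y : H) : ‖gradient L y‖ = ‖fderiv ℝ L y‖ :=
  LinearIsometryEquiv.norm_map _ _

/-- A gradient step of length at most `τ` increases `L` if the gradient varies slowly. -/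
theorem le_apply_add_smul_gradient {L : H → ℝ} {B : Set H}
    (hd : ∀ y ∈ B, DifferentiableAt ℝ L y) {K : NNReal} (hK : LipschitzOnWith K (fderiv ℝ L) B)
    {τ : ℝ} (hτK : τ * K ≤ 1 / 2) {y : H}
    (hy : ∀ u ∈ Set.Icc 0 τ, y + u • gradient L y ∈ B) {s : ℝ} (hs : s ∈ Set.Icc 0 τ) :
    L y + s * (‖gradient L y‖ ^ 2 / 2) ≤ L (y + s • gradient L y) := by
  set X := gradient L y with hX
  have hderiv : ∀ u ∈ Set.Icc 0 τ,
      HasDerivAt (fun u : ℝ => L (y + u • X)) (fderiv ℝ L (y + u • X) X) u := by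
    intro u hu
    have h1 : HasDerivAt (fun u : ℝ => y + u • X) X u := by
      simpa using ((hasDerivAt_id u).smul_const X).const_add y
    exact (hd _ (hy u hu)).hasFDerivAt.comp_hasDerivAt u h1
  have h0 : (0 : ℝ) ∈ Set.Icc 0 τ := ⟨le_rfl, hs.1.trans hs.2⟩
  have hyB : y ∈ B := by simpa using hy 0 h0
  -- The derivative in direction `X` starts at `‖X‖ ^ 2` and changes by at most `u * K * ‖X‖ ^ 2`,
  -- which is at most half of it.
  have hlow : ∀ u ∈ Set.Icc 0 τ, ‖X‖ ^ 2 / 2 ≤ fderiv ℝ L (y + u • X) X := by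
    intro u hu
    have h1 : ‖(fderiv ℝ L (y + u • X) - fderiv ℝ L y) X‖ ≤ (K * (u * ‖X‖)) * ‖X‖ := by
      refine (ContinuousLinearMap.le_opNorm _ _).trans
        (mul_le_mul_of_nonneg_right ?_ (norm_nonneg _))
      have := hK.norm_sub_le (hy u hu) hyB
      simpa [norm_smul, abs_of_nonneg hu.1] using this
    have h2 := (abs_le.1 h1).1
    have h3 : fderiv ℝ L y X = ‖X‖ ^ 2 := fderiv_gradient_self y
    have h4 : u * K ≤ 1 / 2 := (mul_le_mul_of_nonneg_right hu.2 K.2).trans hτK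
    rw [sub_apply, h3] at h2
    have h5 : (u * K) * ‖X‖ ^ 2 ≤ 1 / 2 * ‖X‖ ^ 2 :=
      mul_le_mul_of_nonneg_right h4 (sq_nonneg _)
    nlinarith
  have := (convex_Icc (0 : ℝ) τ).mul_sub_le_image_sub_of_le_deriv
    (f := fun u : ℝ => L (y + u • X)) (C := ‖X‖ ^ 2 / 2)
    (fun u hu => (hderiv u hu).continuousAt.continuousWithinAt)
    (fun u hu => (hderiv u (interior_subset hu)).differentiableAt.differentiableWithinAt)
    (fun u hu => by rw [(hderiv u (interior_subset hu)).deriv]; exact hlow u (interior_subset hu))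
    0 h0 s hs hs.1
  simp only [zero_smul, add_zero, sub_zero] at this
  linarith

open unitInterval in
/-- Near an isolated critical point `0` of `L`, the set where `L` is larger than `L 0` can be
deformed to a set where `L` is larger by a definite amount. -/
theorem exists_deformation_of_isolated_critical [ProperSpace H] {L : H → ℝ}
    (hL : ContDiffAt ℝ 2 L 0) (hiso : ∀ᶠ y in 𝓝 (0 : H), fderiv ℝ L y = 0 → y = 0) {R : ℝ}
    (hR : 0 < R) :
    ∃ r > 0, r ≤ R ∧ ∃ δ > 0, ∃ Φ : H × I → H,
      ContinuousOn Φ {z | ‖z.1‖ < r ∧ L 0 < L z.1} ∧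
      ∀ y, ‖y‖ < r → L 0 < L y → Φ (y, 0) = y ∧ L 0 + δ ≤ L (Φ (y, 1)) ∧
        ∀ t, ‖Φ (y, t)‖ < R ∧ L 0 < L (Φ (y, t)) := by
  obtain ⟨K, B, hB, hK⟩ := (hL.fderiv_right (m := 1) (by norm_num)).exists_lipschitzOnWith
  have hdiff : ∀ᶠ y in 𝓝 (0 : H), DifferentiableAt ℝ L y :=
    (hL.eventually (by simp)).mono fun y hy => hy.differentiableAt (by norm_num)
  obtain ⟨R₀, hR₀, hball⟩ := Metric.nhds_basis_closedBall.eventually_iff.1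
    (hdiff.and (hiso.and hB))
  set R₁ := min R R₀ with hR₁def
  have hR₁ : 0 < R₁ := lt_min hR hR₀
  have hsub : ∀ y : H, ‖y‖ ≤ R₁ → y ∈ Metric.closedBall (0 : H) R₀ := fun y hy => by
    rw [mem_closedBall_zero_iff]; exact hy.trans (min_le_right _ _)
  have hd : ∀ y ∈ Metric.closedBall (0 : H) R₁, DifferentiableAt ℝ L y :=
    fun y hy => (hball (hsub y (by simpa using hy))).1
  have hK' : LipschitzOnWith K (fderiv ℝ L) (Metric.closedBall (0 : H) R₁) :=
    hK.mono fun y hy => (hball (hsub y (by simpa using hy))).2.2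
  have hcrit : ∀ y : H, ‖y‖ ≤ R₁ → y ≠ 0 → 0 < ‖gradient L y‖ := fun y hy hne => by
    rw [norm_gradient, norm_pos_iff]
    exact fun h => hne ((hball (hsub y hy)).2.1 h)
  have hgc : ContinuousOn (gradient L) (Metric.closedBall (0 : H) R₁) :=
    (LinearIsometryEquiv.continuous _).comp_continuousOn hK'.continuousOn
  have hLc : ContinuousOn L (Metric.closedBall (0 : H) R₁) :=
    fun y hy => (hd y hy).continuousAt.continuousWithinAt
  set ρ := R₁ / 3 with hρdef
  have hρ : 0 < ρ := by positivity
  -- Away from the critical point the gradient is bounded below by compactness; this makes every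
  -- displacement there pay in growth of `L`.
  obtain ⟨μ, hμ, hμX⟩ : ∃ μ > 0, ∀ y : H, ρ / 2 ≤ ‖y‖ → ‖y‖ ≤ R₁ → μ ≤ ‖gradient L y‖ := by
    have hc : IsCompact (Metric.closedBall (0 : H) R₁ ∩ {y | ρ / 2 ≤ ‖y‖}) :=
      (isCompact_closedBall _ _).inter_right (isClosed_le continuous_const continuous_norm)
    obtain ⟨μ, hμ, h⟩ := hc.exists_forall_le' (f := fun y => ‖gradient L y‖) (a := 0)
      (hgc.norm.mono Set.inter_subset_left) fun y hy => hcrit y (by simpa using hy.1) (by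
        rintro rfl
        have := hy.2
        simp only [Set.mem_ofPred_eq, norm_zero] at this
        linarith)
    exact ⟨μ, hμ, fun y h1 h2 => h y ⟨by simpa using h2, h1⟩⟩
  obtain ⟨C, hC⟩ := (isCompact_closedBall (0 : H) R₁).exists_bound_of_continuousOn hgc
  have hC' : ∀ y : H, ‖y‖ ≤ R₁ → ‖gradient L y‖ ≤ |C| + 1 := fun y hy =>
    (hC y (by simpa using hy)).trans ((le_abs_self C).trans (by linarith))
  have hC0 : 0 < |C| + 1 := by positivity
  obtain ⟨τ, hτ, hτC, hτK⟩ : ∃ τ > 0, τ * (|C| + 1) ≤ ρ / 2 ∧ τ * K ≤ 1 / 2 := by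
    refine ⟨min (ρ / 2 / (|C| + 1)) (1 / 2 / (K + 1)), by positivity, ?_, ?_⟩
    · calc _ ≤ ρ / 2 / (|C| + 1) * (|C| + 1) :=
            mul_le_mul_of_nonneg_right (min_le_left _ _) hC0.le
        _ = ρ / 2 := div_mul_cancel₀ _ hC0.ne'
    · have hK1 : (0 : ℝ) < K + 1 := by positivity
      calc _ ≤ 1 / 2 / ((K : ℝ) + 1) * (K + 1) :=
            mul_le_mul (min_le_right _ _) (le_add_of_nonneg_right zero_le_one) K.2 (by positivity)
        _ = 1 / 2 := div_mul_cancel₀ _ hK1.ne'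
  set a := μ / 2 with hadef
  have ha : 0 < a := by positivity
  set δ := a * ρ / 2 with hδdef
  have hδ : 0 < δ := by positivity
  set c := L 0 with hc
  -- A trapping region: distance travelled beyond `ρ` must be matched by growth of `L` at rate `a =
  -- μ / 2`. Since `2 * δ = a * ρ`, points of `Q` with `L - c < 2 * δ` have norm below `2 * ρ`, so a
  -- further step, of length at most `ρ / 2`, stays in the ball of radius `R₁ = 3 * ρ`.
  let Q : Set H := {y | ‖y‖ < R₁ ∧ c < L y ∧ a * (‖y‖ - ρ) ≤ L y - c}
  have hactive : ∀ y ∈ Q, L y - c < 2 * δ → ‖y‖ < 2 * ρ := by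
    intro y hy h
    have h1 : a * (‖y‖ - ρ) < a * ρ := hy.2.2.trans_lt (by rw [hδdef] at h; linarith)
    have := lt_of_mul_lt_mul_left h1 ha.le
    linarith
  have hstep : ∀ y : H, ‖y‖ < 2 * ρ → ∀ s ∈ Set.Icc 0 τ,
      ‖s • gradient L y‖ ≤ ρ / 2 ∧ y + s • gradient L y ∈ Metric.closedBall (0 : H) R₁ := by
    intro y hy s hs
    have h1 : ‖s • gradient L y‖ ≤ ρ / 2 := by
      rw [norm_smul, Real.norm_eq_abs, abs_of_nonneg hs.1]
      exact (mul_le_mul hs.2 (hC' y (by linarith)) (norm_nonneg _) hτ.le).trans hτC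
    refine ⟨h1, ?_⟩
    rw [mem_closedBall_zero_iff]
    have := norm_add_le y (s • gradient L y)
    linarith
  have hgain : ∀ y : H, ‖y‖ < 2 * ρ → ∀ s ∈ Set.Icc 0 τ,
      L y + s * (‖gradient L y‖ ^ 2 / 2) ≤ L (y + s • gradient L y) := fun y hy s hs =>
    le_apply_add_smul_gradient hd hK' hτK (fun u hu => (hstep y hy u hu).2) hs
  have hpres : ∀ y ∈ Q, ‖y‖ < 2 * ρ → ∀ s ∈ Set.Icc 0 τ, y + s • gradient L y ∈ Q := by
    intro y hy hy2 s hs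
    have h1 := hgain y hy2 s hs
    have h2 := (hstep y hy2 s hs).1
    have h3 := norm_add_le y (s • gradient L y)
    have h4 : 0 ≤ s * (‖gradient L y‖ ^ 2 / 2) := mul_nonneg hs.1 (by positivity)
    have hyc := hy.2.1
    refine ⟨by linarith, by linarith, ?_⟩
    -- Near the centre, a step of length at most `ρ / 2` cannot leave the ball of radius `ρ`, where
    -- the trapping inequality is automatic. Elsewhere the gain `s * ‖X‖ ^ 2 / 2` is at least `a`
    -- times the step length.
    by_cases hyρ : ‖y‖ ≤ ρ / 2
    · have : a * (‖y + s • gradient L y‖ - ρ) ≤ 0 :=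
        mul_nonpos_of_nonneg_of_nonpos ha.le (by linarith)
      linarith
    · have h5 := hμX y (not_le.1 hyρ).le hy.1.le
      have h6 : ‖s • gradient L y‖ = s * ‖gradient L y‖ := by
        rw [norm_smul, Real.norm_eq_abs, abs_of_nonneg hs.1]
      have h7 : a * (s * ‖gradient L y‖) ≤ s * (‖gradient L y‖ ^ 2 / 2) := by
        have : (s * ‖gradient L y‖) * μ ≤ (s * ‖gradient L y‖) * ‖gradient L y‖ :=
          mul_le_mul_of_nonneg_left h5 (mul_nonneg hs.1 (norm_nonneg _))
        rw [hadef]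
        linarith
      have h8 : a * (‖y + s • gradient L y‖ - ρ) ≤ a * (‖y‖ - ρ) + a * (s * ‖gradient L y‖) := by
        rw [← mul_add]
        exact mul_le_mul_of_nonneg_left (by linarith) ha.le
      have := hy.2.2
      linarith
  -- Full steps are taken up to level `c + δ`, and none from level `c + 2 * δ` on.
  let θ : H → I := fun y => Set.projIcc (0 : ℝ) 1 zero_le_one (2 - (L y - c) / δ)
  have hθ0 : ∀ y, 2 * δ ≤ L y - c → (θ y : ℝ) = 0 := fun y hy => by
    have : 2 - (L y - c) / δ ≤ 0 := by rw [sub_nonpos, le_div_iff₀ hδ]; exact hy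
    simp only [θ, Set.projIcc_of_le_left zero_le_one this]
  have hθ1 : ∀ y, L y - c ≤ δ → (θ y : ℝ) = 1 := fun y hy => by
    have : 1 ≤ 2 - (L y - c) / δ := by
      have : (L y - c) / δ ≤ 1 := by rw [div_le_iff₀ hδ]; linarith
      linarith
    simp only [θ, Set.projIcc_of_right_le zero_le_one this]
  have hsI : ∀ (y : H) (s : I), (s : ℝ) * θ y * τ ∈ Set.Icc 0 τ := fun y s =>
    ⟨mul_nonneg (mul_nonneg s.2.1 (θ y).2.1) hτ.le,
      mul_le_of_le_one_left hτ.le (mul_le_one₀ s.2.2 (θ y).2.1 (θ y).2.2)⟩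
  have hhQ : ∀ y ∈ Q, ∀ s : I, y + ((s : ℝ) * θ y * τ) • gradient L y ∈ Q ∧
      L y ≤ L (y + ((s : ℝ) * θ y * τ) • gradient L y) := by
    intro y hy s
    by_cases hya : L y - c < 2 * δ
    · have h2 := hactive y hy hya
      refine ⟨hpres y hy h2 _ (hsI y s), le_trans ?_ (hgain y h2 _ (hsI y s))⟩
      exact le_add_of_nonneg_right (mul_nonneg (hsI y s).1 (by positivity))
    · rw [hθ0 y (not_lt.1 hya)]
      simpa using hy
  have hQball : ∀ y ∈ Q, y ∈ Metric.closedBall (0 : H) R₁ := fun y hy => by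
    rw [mem_closedBall_zero_iff]; exact hy.1.le
  have hLQ : Continuous fun y : Q => L y := hLc.comp_continuous continuous_subtype_val
    fun y => hQball y y.2
  have hgQ : Continuous fun y : Q => gradient L y := hgc.comp_continuous continuous_subtype_val
    fun y => hQball y y.2
  let h : Q × I → Q := fun z => ⟨z.1 + ((z.2 : ℝ) * θ z.1 * τ) • gradient L z.1, (hhQ _ z.1.2 z.2).1⟩
  have hhc : Continuous h := by
    have hθc : Continuous fun y : Q => θ y :=
      continuous_projIcc.comp (continuous_const.sub ((hLQ.sub continuous_const).div_const δ))
    exact ((continuous_subtype_val.comp continuous_fst).add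
      ((((continuous_subtype_val.comp continuous_snd).mul
        (continuous_subtype_val.comp (hθc.comp continuous_fst))).mul continuous_const).smul
        (hgQ.comp continuous_fst))).subtype_mk _
  have hlarge : ∀ y : Q, ∃ k : ℕ, c + δ / 2 < L ((fun y => h (y, 1))^[k] y) := by
    intro y
    by_contra! hcon
    set x : ℕ → Q := fun k => (fun y => h (y, 1))^[k] y with hx
    have hxs : ∀ k, x (k + 1) = h (x k, 1) := fun k => Function.iterate_succ_apply' _ _ _
    have hmono : ∀ k, L y ≤ L (x k) := by
      intro k
      induction k with
      | zero => exact le_rfl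
      | succ k ih => rw [hxs]; exact ih.trans (hhQ _ (x k).2 1).2
    -- An orbit that never rises stays in a compact set where `L` is at least its initial value. As
    -- that value exceeds `L 0`, the set omits the critical point, so every step gains a fixed
    -- amount, which is absurd.
    have hcpt : IsCompact (Metric.closedBall (0 : H) R₁ ∩ L ⁻¹' (Set.Ici (L y))) :=
      (isCompact_closedBall _ _).of_isClosed_subset
        (hLc.preimage_isClosed_of_isClosed Metric.isClosed_closedBall isClosed_Ici)
        Set.inter_subset_left
    obtain ⟨ν, hν, hνX⟩ := hcpt.exists_forall_le' (f := fun y => ‖gradient L y‖) (a := 0)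
      (hgc.norm.mono Set.inter_subset_left) fun z hz => hcrit z (by simpa using hz.1) (by
        rintro rfl
        have h1 : L y ≤ c := hz.2
        exact absurd y.2.2.1 (not_lt.2 h1))
    have hgrow : ∀ k : ℕ, L y + k * (τ * (ν ^ 2 / 2)) ≤ L (x k) := by
      intro k
      induction k with
      | zero => simp [hx]
      | succ k ih =>
        have h1 : L (x k) - c ≤ δ := by have := hcon k; linarith
        have h2 := hactive _ (x k).2 (by linarith)
        have h3 := hgain _ h2 τ ⟨hτ.le, le_rfl⟩
        have h4 : (x (k + 1) : H) = x k + τ • gradient L (x k) := by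
          rw [hxs]; simp [h, hθ1 _ h1]
        have h5 : τ * (ν ^ 2 / 2) ≤ τ * (‖gradient L (x k : H)‖ ^ 2 / 2) := by
          have := hνX _ ⟨hQball _ (x k).2, hmono k⟩
          gcongr
        rw [h4]
        push_cast
        linarith
    obtain ⟨k, hk⟩ := exists_nat_gt ((c + δ) / (τ * (ν ^ 2 / 2)) - L y / (τ * (ν ^ 2 / 2)))
    have hpos : 0 < τ * (ν ^ 2 / 2) := by positivity
    rw [← sub_div, div_lt_iff₀ hpos] at hk
    have h1 := hgrow k
    have h2 := hcon k
    linarith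
  obtain ⟨Φ, hΦc, hΦ0, hΦL, hΦ1⟩ := exists_deformation_of_iterate hhc
    (fun y => Subtype.ext (by simp [h])) hLQ (fun y s => (hhQ _ y.2 s).2) hlarge
  classical
  have hQ : ∀ y : H, ‖y‖ < ρ → c < L y → y ∈ Q := fun y hy hyc =>
    ⟨by linarith, hyc,
      (mul_nonpos_of_nonneg_of_nonpos ha.le (by linarith)).trans (by linarith)⟩
  -- The value `0` outside `Q` is never used: the ball of radius `ρ` above level `c` lies in `Q`.
  let Φ' : H × I → H := fun z => if hz : z.1 ∈ Q then Φ (⟨z.1, hz⟩, z.2) else 0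
  have hΦ' : ∀ y (hy : y ∈ Q) t, Φ' (y, t) = Φ (⟨y, hy⟩, t) := fun y hy t => dif_pos hy
  refine ⟨ρ, hρ, ?_, δ / 2, by positivity, Φ', ?_, fun y hy hyc => ⟨?_, ?_, fun t => ⟨?_, ?_⟩⟩⟩
  · have : R₁ ≤ R := min_le_left _ _
    linarith
  · rw [continuousOn_iff_continuous_domRestrict]
    have : Continuous fun z : {z : H × I | ‖z.1‖ < ρ ∧ c < L z.1} =>
        (Φ (⟨z.1.1, hQ _ z.2.1 z.2.2⟩, z.1.2) : H) := by fun_prop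
    exact this.congr fun z => (hΦ' _ (hQ _ z.2.1 z.2.2) _).symm
  · rw [hΦ' y (hQ y hy hyc), hΦ0]
  · rw [hΦ' y (hQ y hy hyc)]
    exact hΦ1 _
  · rw [hΦ' y (hQ y hy hyc)]
    exact (Φ _).2.1.trans_le (min_le_left _ _)
  · rw [hΦ' y (hQ y hy hyc)]
    exact (Φ _).2.2.1

end GradientAscent

/-! ### Graph charts -/

/-- Around each of its points, `S` is the graph of a smooth function over a hyperplane. -/
theorem exists_graph_chart {N : ℕ} {S : Set (EuclideanSpace ℝ (Fin (N + 1)))}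
    (hS : IsStrictlyConvexHypersurface S) {x : EuclideanSpace ℝ (Fin (N + 1))} (hx : x ∈ S) :
    ∃ (φ : EuclideanSpace ℝ (Fin N) → EuclideanSpace ℝ (Fin (N + 1)))
      (ρ : EuclideanSpace ℝ (Fin (N + 1)) →L[ℝ] EuclideanSpace ℝ (Fin N)),
      φ 0 = x ∧ ContDiffAt ℝ ∞ φ 0 ∧ (∀ᶠ y in 𝓝 0, φ y ∈ S ∧ ρ (φ y - x) = y) ∧
      ∀ᶠ z in 𝓝 x, z ∈ S → φ (ρ (z - x)) = z := by
  obtain ⟨K, -, -, -, -, hloc⟩ := hS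
  obtain ⟨V, f, hVo, hxV, hf, -, hSV, hfx, -⟩ := hloc x hx
  have hVx : V ∈ 𝓝 x := hVo.mem_nhds hxV
  have hfS : ∀ z ∈ V, z ∈ S ↔ f z = 0 := fun z hz => by
    have : z ∈ S ∩ V ↔ z ∈ {y | y ∈ V ∧ f y = 0} := by rw [hSV]
    simpa [hz] using this
  have hfc : ContDiffAt ℝ ∞ f x := hf.contDiffAt hVx
  set l : EuclideanSpace ℝ (Fin (N + 1)) →L[ℝ] ℝ := fderiv ℝ f x with hl
  obtain ⟨v, hv⟩ : ∃ v, l v = 1 := by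
    obtain ⟨v, hv⟩ := DFunLike.ne_iff.1 hfx
    exact ⟨(l v)⁻¹ • v, by rw [map_smul, smul_eq_mul, inv_mul_cancel₀ hv]⟩
  -- This map has the identity as derivative at `x` and satisfies `l (Ψ z) = f z`, so it straightens
  -- `S` to the hyperplane `ker l`.
  let Ψ : EuclideanSpace ℝ (Fin (N + 1)) → EuclideanSpace ℝ (Fin (N + 1)) :=
    fun z => (z - x) + (f z - l (z - x)) • v
  have hΨx : Ψ x = 0 := by simp [Ψ, (hfS x hxV).1 hx]
  have hlΨ : ∀ z, l (Ψ z) = f z := fun z => by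
    simp only [Ψ, map_add, map_smul, hv, smul_eq_mul, mul_one]; ring
  have hΨc : ContDiffAt ℝ ∞ Ψ x := by
    have h1 : ContDiffAt ℝ ∞ (fun z => z - x) x := contDiffAt_id.sub contDiffAt_const
    exact h1.add ((hfc.sub (l.contDiff.contDiffAt.comp x h1)).smul contDiffAt_const)
  have hΨd : HasFDerivAt Ψ
      ((ContinuousLinearEquiv.refl ℝ (EuclideanSpace ℝ (Fin (N + 1)))) :
        EuclideanSpace ℝ (Fin (N + 1)) →L[ℝ] EuclideanSpace ℝ (Fin (N + 1))) x := by
    have h1 : HasFDerivAt (fun z => z - x) (ContinuousLinearMap.id ℝ _) x :=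
      (hasFDerivAt_id x).sub_const x
    have h2 : HasFDerivAt f l x := (hfc.differentiableAt (by simp)).hasFDerivAt
    have h3 := h1.add ((h2.sub (l.hasFDerivAt.comp x h1)).smul_const v)
    refine h3.congr_fderiv ?_
    ext w
    simp
  let e := hΨc.toOpenPartialHomeomorph Ψ hΨd (by simp)
  have heΨ : (e : _ → _) = Ψ := hΨc.toOpenPartialHomeomorph_coe hΨd (by simp)
  have hxe : x ∈ e.source := hΨc.mem_toOpenPartialHomeomorph_source hΨd (by simp)
  have hsymm : ContDiffAt ℝ ∞ e.symm 0 := by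
    have := hΨc.to_localInverse hΨd (by simp)
    rwa [hΨx] at this
  have h0 : e.symm 0 = x := by rw [← hΨx, ← heΨ]; exact e.left_inv hxe
  have h0e : (0 : EuclideanSpace ℝ (Fin (N + 1))) ∈ e.target := by
    rw [← hΨx, ← heΨ]; exact e.map_source hxe
  have hrank : Module.finrank ℝ l.ker = Module.finrank ℝ (EuclideanSpace ℝ (Fin N)) := by
    have h1 := l.toLinearMap.finrank_range_add_finrank_ker
    have h2 : l.toLinearMap.range = ⊤ := LinearMap.range_eq_top.2 fun r =>
      ⟨r • v, by simp [hv]⟩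
    rw [h2, finrank_top, Module.finrank_self, finrank_euclideanSpace_fin] at h1
    rw [finrank_euclideanSpace_fin]
    have h3 : Module.finrank ℝ l.ker = Module.finrank ℝ l.toLinearMap.ker := rfl
    omega
  let E : l.ker ≃L[ℝ] EuclideanSpace ℝ (Fin N) := ContinuousLinearEquiv.ofFinrankEq hrank
  -- On `S` the straightening coincides with this linear projection along `v`, which is why the
  -- inverse chart is the restriction of a linear map.
  let P : EuclideanSpace ℝ (Fin (N + 1)) →L[ℝ] l.ker :=
    (ContinuousLinearMap.id ℝ _ - l.smulRight v).codRestrict l.ker fun w => by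
      simp [hv]
  have hP : ∀ w, (P w : EuclideanSpace ℝ (Fin (N + 1))) = w - l w • v := fun w => rfl
  have hPΨ : ∀ z, f z = 0 → (P (z - x) : EuclideanSpace ℝ (Fin (N + 1))) = Ψ z := fun z hz => by
    rw [hP]
    simp only [Ψ, hz]
    module
  let ι : EuclideanSpace ℝ (Fin N) → EuclideanSpace ℝ (Fin (N + 1)) := fun y => E.symm y
  have hι0 : ι 0 = 0 := by simp [ι]
  have hιc : ContDiff ℝ ∞ ι := l.ker.subtypeL.contDiff.comp E.symm.contDiff
  refine ⟨fun y => e.symm (ι y), (E : _ →L[ℝ] _).comp P, ?_, ?_, ?_, ?_⟩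
  · exact (congrArg e.symm hι0).trans h0
  · refine ContDiffAt.comp (g := e.symm) 0 ?_ hιc.contDiffAt
    rw [hι0]; exact hsymm
  · have h1 : ∀ᶠ y in 𝓝 (0 : EuclideanSpace ℝ (Fin N)), ι y ∈ e.target :=
      hιc.continuous.continuousAt.eventually (by rw [hι0]; exact e.open_target.mem_nhds h0e)
    have hsc : Filter.Tendsto (fun y => e.symm (ι y)) (𝓝 0) (𝓝 x) := by
      have : ContinuousAt (fun y => e.symm (ι y)) 0 := by
        refine ContinuousAt.comp (g := e.symm) ?_ hιc.continuous.continuousAt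
        rw [hι0]; exact hsymm.continuousAt
      rw [ContinuousAt, hι0, h0] at this
      exact this
    filter_upwards [h1, hsc.eventually hVx] with y hy hyV
    have h2 : Ψ (e.symm (ι y)) = ι y := by rw [← heΨ]; exact e.right_inv hy
    have h3 : f (e.symm (ι y)) = 0 := by
      rw [← hlΨ, h2]; exact (E.symm y).2
    refine ⟨(hfS _ hyV).2 h3, ?_⟩
    have h4 : P (e.symm (ι y) - x) = E.symm y := Subtype.ext (by rw [hPΨ _ h3, h2])
    change E (P _) = y
    rw [h4, E.apply_symm_apply]
  · filter_upwards [hVx, e.open_source.mem_nhds hxe] with z hzV hze hzS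
    have h1 : ι (E (P (z - x))) = Ψ z := by
      simp only [ι, E.symm_apply_apply]
      exact hPΨ z ((hfS z hzV).1 hzS)
    change e.symm (ι (E (P (z - x)))) = z
    rw [h1, ← heΨ]
    exact e.left_inv hze

/-! ### Configurations made of blocks -/

section Blocks

variable {n m : ℕ} [NeZero n] [NeZero m]

/-- The reduction `ℤ/nm → ℤ/n`. -/
abbrev residue (n m : ℕ) : ZMod (n * m) →+* ZMod n := ZMod.castHom (dvd_mul_right n m) (ZMod n)

theorem sum_residue (g : ZMod n → ℝ) : ∑ j, g (residue n m j) = m * ∑ i, g i := by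
  rw [Finset.sum_comp g (residue n m),
    Finset.image_univ_of_surjective (ZMod.castHom_surjective _), Finset.mul_sum]
  exact Finset.sum_congr rfl fun i _ => by rw [card_fiber, nsmul_eq_mul]

theorem prod_residue (g : ZMod n → ℝ) : ∏ j, g (residue n m j) = (∏ i, g i) ^ m := by
  rw [Finset.prod_comp g (residue n m),
    Finset.image_univ_of_surjective (ZMod.castHom_surjective _), ← Finset.prod_pow]
  exact Finset.prod_congr rfl fun i _ => by rw [card_fiber]

theorem sum_zmod_eq_sum_range {M : ℕ} [NeZero M] (g : ZMod M → ℝ) :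
    ∑ j, g j = ∑ k ∈ Finset.range M, g (k : ZMod M) :=
  Finset.sum_bij' (fun j _ => j.val) (fun k _ => (k : ZMod M))
    (fun j _ => Finset.mem_range.2 j.val_lt) (fun _ _ => Finset.mem_univ _)
    (fun j _ => ZMod.natCast_zmod_val j)
    (fun k hk => ZMod.val_cast_of_lt (Finset.mem_range.1 hk))
    (fun j _ => by rw [ZMod.natCast_zmod_val])

/-- A sum over `ℤ/nm` as a sum over `m` blocks of length `n`. -/
theorem sum_blocks (g : ℕ → ZMod n → ℝ) :
    ∑ j : ZMod (n * m), g (j.val / n) (residue n m j) = ∑ i ∈ Finset.range m, ∑ r, g i r := by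
  have hn := NeZero.pos n
  rw [sum_zmod_eq_sum_range]
  have h1 : ∀ k ∈ Finset.range (n * m),
      g ((k : ZMod (n * m)).val / n) (residue n m (k : ZMod (n * m))) = g (k / n) k :=
    fun k hk => by rw [ZMod.val_cast_of_lt (Finset.mem_range.1 hk), map_natCast]
  rw [Finset.sum_congr rfl h1]
  generalize m = l
  induction l with
  | zero => simp
  | succ l ih =>
    rw [Finset.sum_range_succ, ← ih, Nat.mul_succ, Finset.sum_range_add,
      sum_zmod_eq_sum_range (g l)]
    congr 1
    refine Finset.sum_congr rfl fun k hk => ?_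
    rw [Nat.mul_add_div hn, Nat.div_eq_of_lt (Finset.mem_range.1 hk)]
    simp

/-- The total variation of a cyclic sequence which is monotone up to one jump. -/
theorem sum_abs_sub_block_le {s : ℕ → ℝ} (hs : Antitone s) (hs01 : ∀ i, s i ∈ Set.Icc (0 : ℝ) 1) :
    ∑ j : ZMod (n * m), |s ((j + 1).val / n) - s (j.val / n)| ≤ 2 := by
  set M := n * m with hM
  have hMpos : 0 < M := NeZero.pos M
  set u : ℕ → ℝ := fun k => s (k / n) with hu
  have hua : Antitone u := fun a b hab => hs (Nat.div_le_div_right hab)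
  rw [sum_zmod_eq_sum_range]
  -- The decreasing steps telescope to at most `1`; the wrap-around from the last index to `0`
  -- contributes at most another `1`.
  have hle : ∀ k ∈ Finset.range M,
      |s (((k : ZMod M) + 1).val / n) - s ((k : ZMod M).val / n)| ≤
        (u k - u (k + 1)) + if k = M - 1 then 1 else 0 := by
    intro k hk
    have hk' := Finset.mem_range.1 hk
    have hanti : u (k + 1) ≤ u k := hua k.le_succ
    rw [ZMod.val_cast_of_lt hk']
    split_ifs with h
    · have h1 : ∀ i j, |s i - s j| ≤ 1 := fun i j => by
        rw [abs_le]; constructor <;> linarith [(hs01 i).1, (hs01 i).2, (hs01 j).1, (hs01 j).2]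
      linarith [h1 (((k : ZMod M) + 1).val / n) (k / n)]
    · have h1 : ((k : ZMod M) + 1).val = k + 1 := by
        rw [← Nat.cast_succ, ZMod.val_cast_of_lt (by omega)]
      rw [h1, add_zero, abs_sub_comm, abs_of_nonneg (sub_nonneg.2 hanti)]
  refine (Finset.sum_le_sum hle).trans ?_
  rw [Finset.sum_add_distrib, Finset.sum_range_sub', Finset.sum_ite_eq',
    if_pos (Finset.mem_range.2 (by omega))]
  have h1 := (hs01 (0 / n)).2
  have h2 := (hs01 (M / n)).1
  simp only [hu]
  linarith

/-- The length of a configuration whose `i`-th block lies at the parameter `s i` of a segment in a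
chart, compared with the sum of the lengths of the blocks. -/
theorem sum_length_blocks_le {N : ℕ} {F : Type*} [NormedAddCommGroup F] [NormedSpace ℝ F]
    {φ : ZMod n → F → EuclideanSpace ℝ (Fin (N + 1))} {R Λ : ℝ} (hΛ0 : 0 ≤ Λ)
    (hΛ : ∀ j v w, ‖v‖ < R → ‖w‖ < R → ‖φ j v - φ j w‖ ≤ Λ * ‖v - w‖) {y₀ y₁ : ZMod n → F}
    (h₀ : ∀ j, ‖y₀ j‖ < R) (h₁ : ∀ j, ‖y₁ j‖ < R) {s : ℕ → ℝ} (hs : Antitone s)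
    (hs01 : ∀ i, s i ∈ Set.Icc (0 : ℝ) 1) :
    ∑ i ∈ Finset.range m, length (fun r => φ r (AffineMap.lineMap (y₀ r) (y₁ r) (s i)))
        - 4 * Λ * R ≤
      length fun j : ZMod (n * m) => φ (residue n m j)
        (AffineMap.lineMap (y₀ (residue n m j)) (y₁ (residue n m j)) (s (j.val / n))) := by
  let z : ℕ → ZMod n → F := fun i r => AffineMap.lineMap (y₀ r) (y₁ r) (s i)
  have hz : ∀ i r, ‖z i r‖ < R := fun i r => by
    have := (convex_ball (0 : F) R).lineMap_mem (by simpa using h₀ r) (by simpa using h₁ r)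
      (hs01 i)
    simpa using this
  have hzd : ∀ i i' r, ‖z i r - z i' r‖ ≤ |s i - s i'| * (2 * R) := by
    intro i i' r
    have h1 : z i r - z i' r = (s i - s i') • (y₁ r - y₀ r) := by
      simp only [z, AffineMap.lineMap_apply_module']
      module
    rw [h1, norm_smul, Real.norm_eq_abs]
    refine mul_le_mul_of_nonneg_left ((norm_sub_le _ _).trans ?_) (abs_nonneg _)
    linarith [h₀ r, h₁ r]
  -- Compare with blocks closed up at their own parameter: only the far end of an edge changes, from
  -- `s (j.val / n)` to the parameter of the next index, moving by at most `2 * R` times the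
  -- difference. The total variation `2` then yields `4 * Λ * R`.
  have hterm : ∀ j : ZMod (n * m),
      ‖φ (residue n m j + 1) (z (j.val / n) (residue n m j + 1))
          - φ (residue n m j) (z (j.val / n) (residue n m j))‖
        - 2 * Λ * R * |s ((j + 1).val / n) - s (j.val / n)| ≤
      ‖φ (residue n m (j + 1)) (z ((j + 1).val / n) (residue n m (j + 1)))
        - φ (residue n m j) (z (j.val / n) (residue n m j))‖ := by
    intro j
    rw [map_add, map_one]
    have h1 := hΛ (residue n m j + 1) _ _ (hz ((j + 1).val / n) (residue n m j + 1))
      (hz (j.val / n) (residue n m j + 1))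
    have h2 := mul_le_mul_of_nonneg_left
      (hzd ((j + 1).val / n) (j.val / n) (residue n m j + 1)) hΛ0
    have h3 := norm_sub_le_norm_sub_add_norm_sub
      (φ (residue n m j + 1) (z (j.val / n) (residue n m j + 1)))
      (φ (residue n m j + 1) (z ((j + 1).val / n) (residue n m j + 1)))
      (φ (residue n m j) (z (j.val / n) (residue n m j)))
    rw [norm_sub_rev (φ (residue n m j + 1) (z (j.val / n) (residue n m j + 1)))
      (φ (residue n m j + 1) (z ((j + 1).val / n) (residue n m j + 1)))] at h3
    linarith
  have hsum := Finset.sum_le_sum fun j (_ : j ∈ Finset.univ) => hterm j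
  rw [Finset.sum_sub_distrib, ← Finset.mul_sum,
    sum_blocks fun i r => ‖φ (r + 1) (z i (r + 1)) - φ r (z i r)‖] at hsum
  have hR : 0 ≤ R := (norm_nonneg _).trans (h₀ 0).le
  have hvar := mul_le_mul_of_nonneg_left (sum_abs_sub_block_le (n := n) (m := m) hs hs01)
    (by positivity : 0 ≤ 2 * Λ * R)
  unfold length
  linarith

theorem antitone_clamp (t : ℝ) :
    Antitone fun i : ℕ => (Set.projIcc (0 : ℝ) 1 zero_le_one (t - i) : ℝ) := fun _ _ hab =>
  Set.monotone_projIcc zero_le_one (sub_le_sub_left (Nat.cast_le.2 hab) t)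

/-- Moving blocks one at a time, all blocks but at most one are at an end of the path. -/
theorem le_sum_clamp {ℓ : ℝ → ℝ} {A B : ℝ} (hA : ∀ s ∈ Set.Icc (0 : ℝ) 1, A ≤ ℓ s) (hAB : A ≤ B)
    (h0 : B ≤ ℓ 0) (h1 : B ≤ ℓ 1) (t : ℝ) (l : ℕ) :
    l * B - (B - A) ≤
      ∑ i ∈ Finset.range l, ℓ (Set.projIcc (0 : ℝ) 1 zero_le_one (t - i)) := by
  classical
  have hterm : ∀ i ∈ Finset.range l, B - (if 0 < t - i ∧ t - i < 1 then B - A else 0) ≤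
      ℓ (Set.projIcc (0 : ℝ) 1 zero_le_one (t - i)) := by
    intro i _
    split_ifs with h
    · rw [sub_sub_cancel]
      exact hA _ (Set.projIcc (0 : ℝ) 1 zero_le_one (t - i)).2
    · rw [sub_zero]
      by_cases hi : 0 < t - i
      · rw [Set.projIcc_of_right_le _ (not_lt.1 fun h' => h ⟨hi, h'⟩)]
        exact h1
      · rw [Set.projIcc_of_le_left _ (not_lt.1 hi)]
        exact h0
  refine le_trans ?_ (Finset.sum_le_sum hterm)
  rw [Finset.sum_sub_distrib, Finset.sum_const, Finset.card_range, nsmul_eq_mul,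
    ← Finset.sum_filter, Finset.sum_const, nsmul_eq_mul]
  -- An open unit interval of indices contains at most one integer.
  have hcard : ((Finset.range l).filter fun i : ℕ => 0 < t - i ∧ t - i < 1).card ≤ 1 := by
    rw [Finset.card_le_one]
    intro a ha b hb
    have ha' := (Finset.mem_filter.1 ha).2
    have hb' := (Finset.mem_filter.1 hb).2
    have h1 : (a : ℝ) < b + 1 := by linarith
    have h2 : (b : ℝ) < a + 1 := by linarith
    have h3 : a < b + 1 := by exact_mod_cast h1
    have h4 : b < a + 1 := by exact_mod_cast h2
    omega
  have : (((Finset.range l).filter fun i : ℕ => 0 < t - i ∧ t - i < 1).card : ℝ) * (B - A) ≤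
      1 * (B - A) :=
    mul_le_mul_of_nonneg_right (by exact_mod_cast hcard) (sub_nonneg.2 hAB)
  linarith

/-- Configurations in `ℤ/nm` which are uniformly close to an iterate. -/
theorem mem_superlevel_of_near {N : ℕ} {S : Set (EuclideanSpace ℝ (Fin (N + 1)))}
    {q : ZMod n → EuclideanSpace ℝ (Fin (N + 1))} {η ε ε₀ b : ℝ} (hε : 0 < ε) (hle : ε ≤ ε₀)
    (hpos : ∀ i, 0 < ‖q i - q (i - 1)‖ - 2 * η)
    (hgap : ε₀ ^ n ≤ ∏ i, (‖q i - q (i - 1)‖ - 2 * η))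
    (hb : b < ∑ i, (‖q (i + 1) - q i‖ - 2 * η))
    {x : ZMod (n * m) → EuclideanSpace ℝ (Fin (N + 1))} (hxS : ∀ j, x j ∈ S)
    (hx : ∀ j, ‖x j - q (residue n m j)‖ ≤ η) : x ∈ superlevel S (n * m) ε (m * b) := by
  have hdist : ∀ i j, ‖q (residue n m i) - q (residue n m j)‖ - 2 * η ≤ ‖x i - x j‖ := by
    intro i j
    have h1 := norm_sub_le_norm_sub_add_norm_sub (q (residue n m i)) (x i) (q (residue n m j))
    have h2 := norm_sub_le_norm_sub_add_norm_sub (x i) (x j) (q (residue n m j))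
    have h3 := hx i
    have h4 := hx j
    rw [norm_sub_rev] at h3
    linarith
  refine ⟨⟨⟨hxS, fun j hj => ?_⟩, ?_⟩, ?_⟩
  · have h1 := hdist (j + 1) j
    rw [← hj, sub_self, norm_zero] at h1
    have h2 := hpos (residue n m (j + 1))
    rw [← map_one (residue n m), ← map_sub, add_sub_cancel_right] at h2
    linarith
  · calc ε ^ (n * m) = (ε ^ n) ^ m := pow_mul _ _ _
      _ ≤ (∏ i, (‖q i - q (i - 1)‖ - 2 * η)) ^ m :=
        pow_le_pow_left₀ (by positivity) ((pow_le_pow_left₀ hε.le hle n).trans hgap) m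
      _ = ∏ j, (‖q (residue n m j) - q (residue n m j - 1)‖ - 2 * η) :=
        (prod_residue fun i => ‖q i - q (i - 1)‖ - 2 * η).symm
      _ ≤ gapProd x := Finset.prod_le_prod (fun j _ => (hpos _).le) fun j _ => by
        have := hdist j (j - 1)
        rwa [map_sub, map_one] at this
  · calc (m : ℝ) * b < m * ∑ i, (‖q (i + 1) - q i‖ - 2 * η) :=
        mul_lt_mul_of_pos_left hb (by exact_mod_cast NeZero.pos m)
      _ = ∑ j, (‖q (residue n m j + 1) - q (residue n m j)‖ - 2 * η) :=
        (sum_residue fun i => ‖q (i + 1) - q i‖ - 2 * η).symm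
      _ ≤ length x := Finset.sum_le_sum fun j _ => by
        have := hdist (j + 1) j
        rwa [map_add, map_one] at this

end Blocks

/-! ### Charts of the configuration space -/

/-- A product of graph charts around the points of a configuration `q`. -/
structure ConfChart {N n : ℕ} (V : Type*) [NormedAddCommGroup V] [NormedSpace ℝ V]
    (S : Set (EuclideanSpace ℝ (Fin (N + 1)))) (q : ZMod n → EuclideanSpace ℝ (Fin (N + 1))) where
  /-- The parametrizations. -/
  param : ZMod n → V → EuclideanSpace ℝ (Fin (N + 1))
  /-- The projections to the hyperplanes. -/
  proj : ZMod n → EuclideanSpace ℝ (Fin (N + 1)) →L[ℝ] V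
  param_zero : ∀ j, param j 0 = q j
  contDiffAt_param : ∀ j, ContDiffAt ℝ ∞ (param j) 0
  param_mem : ∀ j, ∀ᶠ v in 𝓝 0, param j v ∈ S
  proj_param : ∀ j, ∀ᶠ v in 𝓝 0, proj j (param j v - q j) = v
  param_proj : ∀ j, ∀ᶠ z in 𝓝 (q j), z ∈ S → param j (proj j (z - q j)) = z

theorem nonempty_confChart {N n : ℕ} {S : Set (EuclideanSpace ℝ (Fin (N + 1)))}
    (hS : IsStrictlyConvexHypersurface S) {q : ZMod n → EuclideanSpace ℝ (Fin (N + 1))}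
    (hq : ∀ j, q j ∈ S) : 
    Nonempty (ConfChart (EuclideanSpace ℝ (Fin N)) S q) := by
  choose φ ρ h0 hφ hy hz using fun j => exists_graph_chart hS (hq j)
  exact ⟨⟨φ, ρ, h0, hφ, fun j => (hy j).mono fun _ h => h.1, fun j => (hy j).mono fun _ h => h.2,
    hz⟩⟩

theorem eventually_forall_apply {n : ℕ} [NeZero n] {V : Type*} [NormedAddCommGroup V]
    {P : ZMod n → V → Prop} (h : ∀ j, ∀ᶠ v in 𝓝 0, P j v) :
    ∀ᶠ y : PiLp 2 (fun _ : ZMod n => V) in 𝓝 0, ∀ j, P j (y j) :=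
  Filter.eventually_all.2 fun j => (PiLp.continuous_apply 2 _ j).continuousAt.eventually (h j)

namespace ConfChart

variable {N n : ℕ} {S : Set (EuclideanSpace ℝ (Fin (N + 1)))}
  {q : ZMod n → EuclideanSpace ℝ (Fin (N + 1))} 
  {V : Type*} [NormedAddCommGroup V] [NormedSpace ℝ V] (C : ConfChart V S q)

/-- The parametrization of the configuration space. -/
def conf (y : PiLp 2 fun _ : ZMod n => V) :
    ZMod n → EuclideanSpace ℝ (Fin (N + 1)) :=
  fun j => C.param j (y j)

/-- The coordinates of a configuration. -/
def coord (x : ZMod n → EuclideanSpace ℝ (Fin (N + 1))) :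
    PiLp 2 fun _ : ZMod n => V :=
  WithLp.toLp 2 fun j => C.proj j (x j - q j)

theorem conf_zero : C.conf 0 = q := funext C.param_zero

theorem coord_self : C.coord q = 0 := by
  ext j
  simp [coord]

theorem continuous_coord : Continuous C.coord := by
  unfold coord
  fun_prop

theorem continuousAt_conf : ContinuousAt C.conf 0 := by
  refine continuousAt_pi.2 fun j => ?_
  exact ContinuousAt.comp (g := C.param j) (C.contDiffAt_param j).continuousAt
    (PiLp.continuous_apply 2 _ j).continuousAt

theorem conf_coord [NeZero n] :
    ∀ᶠ x in 𝓝 q, (∀ j, x j ∈ S) → C.conf (C.coord x) = x := by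
  have h : ∀ᶠ x : ZMod n → EuclideanSpace ℝ (Fin (N + 1)) in 𝓝 q,
      ∀ j, x j ∈ S → C.param j (C.proj j (x j - q j)) = x j :=
    Filter.eventually_all.2 fun j => (continuous_apply j).continuousAt.eventually (C.param_proj j)
  exact h.mono fun x hx hxS => funext fun j => hx j (hxS j)

theorem coord_conf [NeZero n] : ∀ᶠ y in 𝓝 0, C.coord (C.conf y) = y :=
  (eventually_forall_apply C.proj_param).mono fun _ hy => PiLp.ext hy

theorem conf_mem [NeZero n] (hq : q ∈ Billiard.conf S n) : ∀ᶠ y in 𝓝 0, C.conf y ∈ Billiard.conf S n := by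
  have h : ∀ᶠ x : ZMod n → EuclideanSpace ℝ (Fin (N + 1)) in 𝓝 q, ∀ j, x j ≠ x (j + 1) :=
    Filter.eventually_all.2 fun j => ((continuous_apply j).continuousAt.ne_iff_eventually_ne
      (continuous_apply (j + 1)).continuousAt).1 (hq.2 j)
  have hc := C.continuousAt_conf
  rw [ContinuousAt, conf_zero] at hc
  filter_upwards [eventually_forall_apply C.param_mem, hc.eventually h] with y h1 h2 using ⟨h1, h2⟩

theorem contDiffAt_length_conf [NeZero n] (hq : q ∈ Billiard.conf S n) :
    ContDiffAt ℝ ∞ (fun y => length (C.conf y)) 0 := by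
  have h : ∀ j, ContDiffAt ℝ ∞ (fun y => C.conf y j) 0 := fun j =>
    ContDiffAt.comp (g := C.param j) 0 (C.contDiffAt_param j) (contDiff_piLp_apply 2).contDiffAt
  refine ContDiffAt.sum fun j _ => ((h (j + 1)).sub (h j)).norm ℝ ?_
  rw [conf_zero, sub_ne_zero]
  exact (hq.2 j).symm

end ConfChart

theorem differentiableAt_length {N n : ℕ} [NeZero n] {S : Set (EuclideanSpace ℝ (Fin (N + 1)))}
    {x : ZMod n → EuclideanSpace ℝ (Fin (N + 1))} (hx : x ∈ conf S n) :
    DifferentiableAt ℝ length x := by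
  refine DifferentiableAt.fun_sum fun j _ => DifferentiableAt.norm ℝ (by fun_prop) ?_
  rw [sub_ne_zero]
  exact (hx.2 j).symm

namespace ConfChart

variable {N n : ℕ} {S : Set (EuclideanSpace ℝ (Fin (N + 1)))}
  {q : ZMod n → EuclideanSpace ℝ (Fin (N + 1))} 
  {V : Type*} [NormedAddCommGroup V] [NormedSpace ℝ V] (C : ConfChart V S q)

/-- Tangent vectors are velocities of curves in `S`. In coordinates such a curve is differentiable,
so the length along it has derivative zero by the chain rule through the chart. -/
theorem isCritical_conf [NeZero n] {y : PiLp 2 fun _ : ZMod n => V}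
    (hy : C.conf y ∈ Billiard.conf S n) (hyc : C.coord (C.conf y) = y)
    (hz : ∀ᶠ x in 𝓝 (C.conf y), (∀ j, x j ∈ S) → C.conf (C.coord x) = x)
    (hd : DifferentiableAt ℝ (fun y => length (C.conf y)) y)
    (h0 : fderiv ℝ (fun y => length (C.conf y)) y = 0) : IsCritical S (C.conf y) := by
  refine ⟨hy, fun v hv => ?_⟩
  choose γ hγ hγS hγ0 hγv using hv
  let g : ℝ → ZMod n → EuclideanSpace ℝ (Fin (N + 1)) := fun t j => γ j t
  have hg0 : g 0 = C.conf y := funext hγ0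
  have hg : HasDerivAt g v 0 := hasDerivAt_pi.2 hγv
  have h1 : HasDerivAt (fun t => length (g t)) (fderiv ℝ length (C.conf y) v) 0 :=
    HasFDerivAt.comp_hasDerivAt_of_eq 0 (differentiableAt_length hy).hasFDerivAt hg hg0.symm
  have h2 : HasDerivAt (fun t => C.coord (g t)) (WithLp.toLp 2 fun j => C.proj j (v j)) 0 :=
    (PiLp.continuousLinearEquiv 2 ℝ fun _ : ZMod n => V).symm.hasFDerivAt.comp_hasDerivAt 0
      (hasDerivAt_pi.2 fun j =>
        (C.proj j).hasFDerivAt.comp_hasDerivAt 0 ((hγv j).sub_const (q j)))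
  have h3 : HasDerivAt (fun t => length (C.conf (C.coord (g t)))) 0 0 := by
    have h4 := HasFDerivAt.comp_hasDerivAt_of_eq 0 hd.hasFDerivAt h2 (by rw [hg0, hyc])
    rwa [h0, zero_apply] at h4
  have h5 : (fun t => length (C.conf (C.coord (g t)))) =ᶠ[𝓝 0] fun t => length (g t) := by
    have hgc : Filter.Tendsto g (𝓝 0) (𝓝 (g 0)) := hg.continuousAt
    rw [hg0] at hgc
    filter_upwards [hgc.eventually hz, Filter.eventually_all.2 hγS] with t ht htS
    rw [ht htS]
  exact (h1.unique (h3.congr_of_eventuallyEq h5.symm))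

/-- Transfers isolatedness to coordinates: a critical point of the length in the chart parametrizes
a critical configuration, which near `q` must be `q`. -/
theorem eventually_fderiv_ne_zero [NeZero n] (hq : IsIsolatedCritical S q) :
    ∀ᶠ y in 𝓝 0, fderiv ℝ (fun y => length (C.conf y)) y = 0 → y = 0 := by
  have hc := C.continuousAt_conf
  rw [ContinuousAt, conf_zero] at hc
  have hd : ∀ᶠ y in 𝓝 0, DifferentiableAt ℝ (fun y => length (C.conf y)) y :=
    (((C.contDiffAt_length_conf hq.1.1).of_le (m := 1) (by simp)).eventually (by simp)).mono
      fun y hy => hy.differentiableAt (by simp)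
  filter_upwards [C.conf_mem hq.1.1, C.coord_conf,
    hc.eventually (eventually_eventually_nhds.2 C.conf_coord), hd, hc.eventually hq.2]
    with y h1 h2 h3 h4 h5 h6
  rw [← h2, h5 (C.isCritical_conf h1 h2 h3 h4 h6), coord_self]

/-- A ball in which the chart behaves uniformly. -/
theorem exists_radius [NeZero n] {η : ℝ} (hη : 0 < η) :
    ∃ R > 0, ∃ Λ ≥ 0, ∀ j, (∀ v, ‖v‖ < R → C.param j v ∈ S ∧ ‖C.param j v - q j‖ ≤ η) ∧
      ∀ v w, ‖v‖ < R → ‖w‖ < R → ‖C.param j v - C.param j w‖ ≤ Λ * ‖v - w‖ := by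
  choose K B hB hK using fun j =>
    ((C.contDiffAt_param j).of_le (m := 1) (by simp)).exists_lipschitzOnWith
  have h : ∀ᶠ v in 𝓝 (0 : V),
      ∀ j, C.param j v ∈ S ∧ ‖C.param j v - q j‖ ≤ η ∧ v ∈ B j := by
    refine Filter.eventually_all.2 fun j => (C.param_mem j).and (Filter.Eventually.and ?_ (hB j))
    have hc := (C.contDiffAt_param j).continuousAt
    rw [ContinuousAt, C.param_zero] at hc
    filter_upwards [hc.eventually (Metric.closedBall_mem_nhds _ hη)] with v hv
    rwa [← dist_eq_norm]
  obtain ⟨R, hR, hball⟩ := Metric.nhds_basis_ball.eventually_iff.1 h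
  have hball' : ∀ v : V, ‖v‖ < R →
      ∀ j, C.param j v ∈ S ∧ ‖C.param j v - q j‖ ≤ η ∧ v ∈ B j :=
    fun v hv => hball (by simpa using hv)
  refine ⟨R, hR, ∑ j, (K j : ℝ), Finset.sum_nonneg fun j _ => (K j).2, fun j =>
    ⟨fun v hv => ⟨(hball' v hv j).1, (hball' v hv j).2.1⟩, fun v w hv hw => ?_⟩⟩
  refine ((hK j).norm_sub_le (hball' v hv j).2.2 (hball' w hw j).2.2).trans
    (mul_le_mul_of_nonneg_right ?_ (norm_nonneg _))
  exact Finset.single_le_sum (f := fun j => (K j : ℝ)) (fun j _ => (K j).2) (Finset.mem_univ j)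

/-- Longer configurations near `q` have coordinates near `0`. -/
theorem exists_longer [NeZero n] (hmax : ¬ IsLocalMaxOn length (Billiard.conf S n) q) {r : ℝ} (hr : 0 < r) :
    ∃ y, ‖y‖ < r ∧ length q < length (C.conf y) := by
  have hfreq : ∃ᶠ x in 𝓝[Billiard.conf S n] q, ¬ length x ≤ length q :=
    Filter.not_eventually.1 hmax
  have hev : ∀ᶠ x in 𝓝[Billiard.conf S n] q,
      x ∈ Billiard.conf S n ∧ ((∀ j, x j ∈ S) → C.conf (C.coord x) = x) ∧ ‖C.coord x‖ < r := by
    refine eventually_mem_nhdsWithin.and (Filter.Eventually.filter_mono nhdsWithin_le_nhds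
      (C.conf_coord.and (C.continuous_coord.norm.continuousAt.eventually (gt_mem_nhds ?_))))
    change ‖C.coord q‖ < r
    rwa [coord_self, norm_zero]
  obtain ⟨x, hx, hxS, hxc, hxr⟩ := (hfreq.and_eventually hev).exists
  exact ⟨C.coord x, hxr, by rw [hxc hxS.1]; exact not_le.1 hx⟩

end ConfChart

/-! ### Moving blocks and conclusion -/

/-- Shrinking all gaps slightly preserves strict bounds on their product and their sum. -/
theorem exists_gap_margin {N n : ℕ} [NeZero n] {S : Set (EuclideanSpace ℝ (Fin (N + 1)))}
    {q : ZMod n → EuclideanSpace ℝ (Fin (N + 1))} (hq : q ∈ conf S n) {a b : ℝ}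
    (ha : a < gapProd q) (hb : b < length q) :
    ∃ η > 0, (∀ i, 0 < ‖q i - q (i - 1)‖ - 2 * η) ∧
      a ≤ ∏ i, (‖q i - q (i - 1)‖ - 2 * η) ∧ b < ∑ i, (‖q (i + 1) - q i‖ - 2 * η) := by
  have h1 : ∀ᶠ η : ℝ in 𝓝 0, ∀ i, 0 < ‖q i - q (i - 1)‖ - 2 * η := by
    refine Filter.eventually_all.2 fun i => ?_
    have hc : ContinuousAt (fun η : ℝ => ‖q i - q (i - 1)‖ - 2 * η) 0 := by fun_prop
    refine hc.eventually (lt_mem_nhds ?_)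
    have := hq.2 (i - 1)
    rw [sub_add_cancel] at this
    simpa [sub_eq_zero] using this.symm
  have h2 : ∀ᶠ η : ℝ in 𝓝 0, a < ∏ i, (‖q i - q (i - 1)‖ - 2 * η) := by
    have hc : ContinuousAt (fun η : ℝ => ∏ i, (‖q i - q (i - 1)‖ - 2 * η)) 0 := by fun_prop
    exact hc.eventually (lt_mem_nhds (by simpa [gapProd] using ha))
  have h3 : ∀ᶠ η : ℝ in 𝓝 0, b < ∑ i, (‖q (i + 1) - q i‖ - 2 * η) := by
    have hc : ContinuousAt (fun η : ℝ => ∑ i, (‖q (i + 1) - q i‖ - 2 * η)) 0 := by fun_prop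
    exact hc.eventually (lt_mem_nhds (by simpa [length] using hb))
  obtain ⟨η, hη, hη0⟩ := (((h1.and (h2.and h3)).filter_mono nhdsWithin_le_nhds).and
    (self_mem_nhdsWithin (s := Set.Ioi (0 : ℝ)))).exists
  exact ⟨η, hη0, hη.1, hη.2.1.le, hη.2.2⟩

theorem le_length_of_near {N n : ℕ} [NeZero n] {q x : ZMod n → EuclideanSpace ℝ (Fin (N + 1))}
    {η : ℝ} (hx : ∀ j, ‖x j - q j‖ ≤ η) : ∑ i, (‖q (i + 1) - q i‖ - 2 * η) ≤ length x := by
  refine Finset.sum_le_sum fun i _ => ?_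
  have h1 := norm_sub_le_norm_sub_add_norm_sub (q (i + 1)) (x (i + 1)) (q i)
  have h2 := norm_sub_le_norm_sub_add_norm_sub (x (i + 1)) (x i) (q i)
  have h3 := hx (i + 1)
  rw [norm_sub_rev] at h3
  linarith [hx i]

/-- The configuration in `ℤ/nm` obtained from `m` copies of `y₀` by moving the blocks one at a time
to `y₁`, at time `s ∈ [0, m]`. -/
def moveBlocks {n m : ℕ} {V : Type*} [NormedAddCommGroup V] [NormedSpace ℝ V] (y₀ y₁ : ZMod n → V)
    (s : ℝ) : ZMod (n * m) → V :=
  fun j => AffineMap.lineMap (y₀ (residue n m j)) (y₁ (residue n m j))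
    (Set.projIcc (0 : ℝ) 1 zero_le_one (s - (j.val / n : ℕ)) : ℝ)

theorem moveBlocks_zero {n m : ℕ} {V : Type*} [NormedAddCommGroup V] [NormedSpace ℝ V]
    (y₀ y₁ : ZMod n → V) :
    (moveBlocks y₀ y₁ 0 : ZMod (n * m) → V) = fun j => y₀ (residue n m j) := by
  funext j
  have h : (0 : ℝ) - (j.val / n : ℕ) ≤ 0 := by rw [zero_sub, neg_nonpos]; positivity
  rw [moveBlocks, Set.projIcc_of_le_left _ h, AffineMap.lineMap_apply_zero]

theorem moveBlocks_last {n m : ℕ} [NeZero n] [NeZero m] {V : Type*} [NormedAddCommGroup V]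
    [NormedSpace ℝ V] (y₀ y₁ : ZMod n → V) :
    (moveBlocks y₀ y₁ m : ZMod (n * m) → V) = fun j => y₁ (residue n m j) := by
  funext j
  have h1 : j.val / n + 1 ≤ m := Nat.div_lt_of_lt_mul j.val_lt
  have h : 1 ≤ (m : ℝ) - (j.val / n : ℕ) := by
    have : ((j.val / n : ℕ) : ℝ) + 1 ≤ m := by exact_mod_cast h1
    linarith
  rw [moveBlocks, Set.projIcc_of_right_le _ h, AffineMap.lineMap_apply_one]

theorem norm_moveBlocks_lt {n m : ℕ} {V : Type*} [NormedAddCommGroup V] [NormedSpace ℝ V]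
    {y₀ y₁ : ZMod n → V} {R : ℝ} (h₀ : ∀ j, ‖y₀ j‖ < R) (h₁ : ∀ j, ‖y₁ j‖ < R) (s : ℝ)
    (j : ZMod (n * m)) : ‖moveBlocks y₀ y₁ s j‖ < R := by
  have := (convex_ball (0 : V) R).lineMap_mem (by simpa using h₀ (residue n m j))
    (by simpa using h₁ (residue n m j))
    (Set.projIcc (0 : ℝ) 1 zero_le_one (s - (j.val / n : ℕ))).2
  rwa [mem_ball_zero_iff] at this

/-- If the segment from `y₀` to `y₁` consists of configurations longer than `b` and its ends are
longer than `c` by `d`, then moving `m` blocks one at a time from `y₀` to `y₁` goes through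
configurations longer than `mc`, for large `m`. -/
theorem lt_length_moveBlocks {N n m : ℕ} [NeZero n] [NeZero m] {V : Type*} [NormedAddCommGroup V]
    [NormedSpace ℝ V] {φ : ZMod n → V → EuclideanSpace ℝ (Fin (N + 1))} {R Λ b c d : ℝ}
    (hΛ0 : 0 ≤ Λ) (hΛ : ∀ j v w, ‖v‖ < R → ‖w‖ < R → ‖φ j v - φ j w‖ ≤ Λ * ‖v - w‖)
    (hb : ∀ y : ZMod n → V, (∀ j, ‖y j‖ < R) → b ≤ length fun j => φ j (y j))
    (hbc : b ≤ c + d) {y₀ y₁ : ZMod n → V} (h₀ : ∀ j, ‖y₀ j‖ < R) (h₁ : ∀ j, ‖y₁ j‖ < R)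
    (hd₀ : c + d ≤ length fun j => φ j (y₀ j)) (hd₁ : c + d ≤ length fun j => φ j (y₁ j))
    (hm : c + d - b + 4 * Λ * R < m * d) (s : ℝ) :
    m * c < length fun j : ZMod (n * m) => φ (residue n m j) (moveBlocks y₀ y₁ s j) := by
  have h1 := sum_length_blocks_le (m := m) hΛ0 hΛ h₀ h₁ (antitone_clamp s)
    fun i => (Set.projIcc (0 : ℝ) 1 zero_le_one (s - i)).2
  have h2 := le_sum_clamp
    (ℓ := fun u => length fun r => φ r (AffineMap.lineMap (y₀ r) (y₁ r) u)) (A := b) (B := c + d)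
    (fun u hu => hb _ fun r => by
      have := (convex_ball (0 : V) R).lineMap_mem (by simpa using h₀ r) (by simpa using h₁ r) hu
      simpa using this)
    hbc (by simpa using hd₀) (by simpa using hd₁) s m
  refine lt_of_lt_of_le ?_ h1
  linarith

-- All the data `η`, `R`, `Λ`, `δ`, `y'` come from `q`, `b` and `ε₀` alone, so the exponent is fixed
-- before `ε` and the degree.
open unitInterval in
theorem exists_iterHomologyMap_eq_zero_of_confChart {N n : ℕ} [NeZero n]
    {S : Set (EuclideanSpace ℝ (Fin (N + 1)))} {q : ZMod n → EuclideanSpace ℝ (Fin (N + 1))}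
    {V : Type*} [NormedAddCommGroup V] [InnerProductSpace ℝ V] [FiniteDimensional ℝ V]
    (C : ConfChart V S q) (hq : IsIsolatedCritical S q)
    (hmax : ¬ IsLocalMaxOn length (conf S n) q) (b : ℝ) (hb : b < length q) (ε₀ : ℝ)
    (hε₀q : ε₀ ^ n < gapProd q) (p : ℕ) (hp : 2 ≤ p) :
    ∃ (m : ℕ) (_ : NeZero m), (∃ k : ℕ, m = p ^ k) ∧
      ∀ (ε : ℝ) (hε : 0 < ε) (hle : ε ≤ ε₀) (j : ℕ),
        iterHomologyMap S hε (mem_confEps_of_le hq.1.1 hε hle hε₀q) hb m j = 0 := by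
  -- The `ℓ²` product makes the coordinate space Euclidean, as gradient ascent requires; the block
  -- estimates only use its components.
  have : ProperSpace (PiLp 2 fun _ : ZMod n => V) := FiniteDimensional.proper ℝ _
  obtain ⟨η, hη, hpos, hgap, hsum⟩ := exists_gap_margin hq.1.1 hε₀q hb
  obtain ⟨R, hR, Λ, hΛ0, hchart⟩ := C.exists_radius hη
  obtain ⟨r, hr, hrR, δ, hδ, Φ, hΦc, hΦ⟩ := exists_deformation_of_isolated_critical
    (by exact_mod_cast contDiffAt_infty.1 (C.contDiffAt_length_conf hq.1.1) 2)
    (C.eventually_fderiv_ne_zero hq) hR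
  simp only [C.conf_zero] at hΦc hΦ
  obtain ⟨y', hy'r, hy'⟩ := C.exists_longer hmax hr
  set c := length q with hc
  -- With this `d` both ends of every block segment, the pushed configuration and `y'`, reach level
  -- `c + d`.
  set d := min δ (length (C.conf y') - c) with hd
  have hd0 : 0 < d := lt_min hδ (sub_pos.2 hy')
  have hdδ : d ≤ δ := min_le_left _ _
  have hdy' : c + d ≤ length (C.conf y') := by
    have : d ≤ length (C.conf y') - c := min_le_right _ _
    linarith
  have hcomp : ∀ y : PiLp 2 (fun _ : ZMod n => V), ‖y‖ < R → ∀ j, ‖y j‖ < R :=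
    fun y hy j => (PiLp.norm_apply_le y j).trans_lt hy
  have hy'R : ∀ j, ‖y' j‖ < R := hcomp y' (hy'r.trans_le hrR)
  -- The loss from the one block in transit and from the seams does not depend on `m`, whereas the
  -- reserve `m * d` grows.
  obtain ⟨k, hk⟩ := pow_unbounded_of_one_lt ((c + d - b + 4 * Λ * R) / d)
    (by exact_mod_cast hp : (1 : ℝ) < p)
  have hm0 : NeZero (p ^ k) := ⟨pow_ne_zero _ (by omega)⟩
  rw [div_lt_iff₀ hd0] at hk
  refine ⟨p ^ k, hm0, ⟨k, rfl⟩, fun ε hε hle j => ?_⟩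
  have hm : c + d - b + 4 * Λ * R < ((p ^ k : ℕ) : ℝ) * d := by exact_mod_cast hk
  generalize p ^ k = m at hm0 hm ⊢
  let κ : (ZMod (n * m) → V) → ZMod (n * m) → EuclideanSpace ℝ (Fin (N + 1)) :=
    fun w j => C.param (residue n m j) (w j)
  let W : Set (ZMod (n * m) → V) := {w | ∀ j, ‖w j‖ < R}
  have hW : Convex ℝ W := by
    have : W = Set.univ.pi fun _ : ZMod (n * m) => Metric.ball (0 : V) R := by
      ext w; simp [W]
    rw [this]
    exact convex_pi fun _ _ => convex_ball _ _
  have hκW : Set.MapsTo κ W (superlevel S (n * m) ε (m * b)) := fun w hw =>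
    mem_superlevel_of_near hε hle hpos hgap hsum (fun j => ((hchart _).1 _ (hw j)).1)
      fun j => ((hchart _).1 _ (hw j)).2
  have hκc : ContinuousOn κ W := by
    refine continuousOn_pi.2 fun j => ?_
    have h1 : ContinuousOn (C.param (residue n m j)) (Metric.ball 0 R) := by
      refine LipschitzOnWith.continuousOn (K := Λ.toNNReal) (LipschitzOnWith.of_dist_le_mul ?_)
      intro v hv w hw
      rw [dist_eq_norm, dist_eq_norm, Real.coe_toNNReal _ hΛ0]
      exact (hchart _).2 v w (by simpa using hv) (by simpa using hw)
    exact h1.comp (continuous_apply j).continuousOn fun w hw => by simpa using hw j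
  have hκA : ∀ w ∈ W, m * c < length (κ w) → κ w ∈ superlevel S (n * m) ε (m * c) :=
    fun w hw h => ⟨(hκW hw).1, h⟩
  have hκiter : ∀ y : PiLp 2 (fun _ : ZMod n => V),
      κ (fun j => y (residue n m j)) = iter m (C.conf y) := fun y => rfl
  have hmpos : (0 : ℝ) < m := by exact_mod_cast NeZero.pos m
  have hnear : ∀ y : ZMod n → V, (∀ j, ‖y j‖ < R) → b ≤ length fun j => C.param j (y j) :=
    fun y hy => hsum.le.trans (le_length_of_near fun j => ((hchart j).1 _ (hy j)).2)
  have hmove : ∀ y : PiLp 2 (fun _ : ZMod n => V), ‖y‖ < R → c + d ≤ length (C.conf y) →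
      ∀ s, m * c < length (κ (moveBlocks y y' s)) := fun y hy hyd s =>
    lt_length_moveBlocks hΛ0 (fun j => (hchart j).2) hnear (by linarith) (hcomp y hy) hy'R hyd
      hdy' hm s
  let α : I → I := fun t => Set.projIcc (0 : ℝ) 1 zero_le_one (2 * t)
  let β : I → I := fun t => Set.projIcc (0 : ℝ) 1 zero_le_one (2 * t - 1)
  have hα : Continuous α := continuous_projIcc.comp (by fun_prop)
  have hβ : Continuous β := continuous_projIcc.comp (by fun_prop)
  -- In the first half of the time `α` runs the gradient ascent in all blocks simultaneously; in the
  -- second, `β` moves the blocks to `y'` one by one.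
  let Γ : (ZMod n → EuclideanSpace ℝ (Fin (N + 1))) × I → ZMod (n * m) → V := fun z =>
    moveBlocks (Φ (C.coord z.1, α z.2)) y' (m * β z.2)
  let U : Set (ZMod n → EuclideanSpace ℝ (Fin (N + 1))) :=
    {x | ((∀ j, x j ∈ S) → C.conf (C.coord x) = x) ∧ ‖C.coord x‖ < r}
  have hU : U ∈ 𝓝 q := by
    refine C.conf_coord.and (C.continuous_coord.norm.continuousAt.eventually (gt_mem_nhds ?_))
    change ‖C.coord q‖ < r
    rwa [C.coord_self, norm_zero]
  have hUA : ∀ x ∈ superlevel S n ε c ∩ U, ‖C.coord x‖ < r ∧ c < length (C.conf (C.coord x)) :=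
    fun x hx => ⟨hx.2.2, by rw [hx.2.1 hx.1.1.1.1]; exact hx.1.2⟩
  have hqS := mem_confEps_of_le hq.1.1 hε hle hε₀q
  have hXS : ∀ x ∈ superlevel S n ε c ∪ {q}, ∀ j, x j ∈ S := by
    rintro x (hx | rfl)
    exacts [hx.1.1.1, hqS.1.1]
  have hΦR : ∀ x ∈ superlevel S n ε c ∩ U, ∀ t j, ‖Φ (C.coord x, t) j‖ < R := fun x hx t =>
    hcomp _ ((hΦ _ (hUA x hx).1 (hUA x hx).2).2.2 t).1
  have hΓW : ∀ x ∈ superlevel S n ε c ∩ U, ∀ t, Γ (x, t) ∈ W := fun x hx t j =>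
    norm_moveBlocks_lt (hΦR x hx _) hy'R _ _
  have hβ0 : ∀ t : I, (t : ℝ) ≤ 1 / 2 → (β t : ℝ) = 0 := fun t ht => by
    have : 2 * (t : ℝ) - 1 ≤ 0 := by linarith
    simp only [β, Set.projIcc_of_le_left zero_le_one this]
  have hα1 : ∀ t : I, 1 / 2 ≤ (t : ℝ) → α t = 1 := fun t ht => by
    have : 1 ≤ 2 * (t : ℝ) := by linarith
    simp only [α, Set.projIcc_of_right_le zero_le_one this]
    rfl
  refine relHomologyMap_eq_zero_of_local_contraction (continuous_iter m) _ _ _ _ q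
    (fun h => lt_irrefl _ h.2) rfl hW hκc hκW hU
    (τ := fun x j => C.coord x (residue n m j)) ?_ ?_ ?_ (Γ := Γ) ?_ hΓW ?_ ?_
    (w := fun j => y' (residue n m j)) (fun j => hy'R _) ?_ ?_ j
  · refine (continuous_pi fun j => ?_).continuousOn
    exact (PiLp.continuous_apply 2 _ _).comp C.continuous_coord
  · exact fun x hx j => hcomp _ (hx.2.2.trans_le hrR) _
  · intro x hx
    rw [hκiter, hx.2.1 (hXS x hx.1)]
  · have h1 : ContinuousOn (fun z : (ZMod n → EuclideanSpace ℝ (Fin (N + 1))) × I =>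
        Φ (C.coord z.1, α z.2)) {z | z.1 ∈ superlevel S n ε c ∩ U} :=
      hΦc.comp ((C.continuous_coord.comp continuous_fst).prodMk
        (hα.comp continuous_snd)).continuousOn fun z hz => hUA _ hz
    refine continuousOn_pi.2 fun j => ?_
    have h2 : ContinuousOn (fun z : (ZMod n → EuclideanSpace ℝ (Fin (N + 1))) × I =>
        Φ (C.coord z.1, α z.2) (residue n m j)) {z | z.1 ∈ superlevel S n ε c ∩ U} :=
      (PiLp.continuous_apply 2 _ _).comp_continuousOn h1
    have h3 : Continuous fun z : (ZMod n → EuclideanSpace ℝ (Fin (N + 1))) × I =>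
        (Set.projIcc (0 : ℝ) 1 zero_le_one (m * β z.2 - (j.val / n : ℕ)) : ℝ) :=
      continuous_subtype_val.comp (continuous_projIcc.comp (by fun_prop))
    simp only [Γ, moveBlocks, AffineMap.lineMap_apply_module]
    exact ((continuousOn_const.sub h3.continuousOn).smul h2).add
      (h3.continuousOn.smul continuousOn_const)
  · intro x hx t
    refine hκA _ (hΓW x hx t) ?_
    obtain ⟨hxr, hxc⟩ := hUA x hx
    -- In the first half the configuration is an iterate, so its length is `m` times one longer than
    -- `c`; in the second the block estimate applies.
    rcases le_total (t : ℝ) (1 / 2) with ht | ht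
    · simp only [Γ, hβ0 t ht, mul_zero, moveBlocks_zero]
      rw [hκiter, length_iter]
      exact mul_lt_mul_of_pos_left ((hΦ _ hxr hxc).2.2 _).2 hmpos
    · simp only [Γ, hα1 t ht]
      exact hmove _ ((hΦ _ hxr hxc).2.2 1).1 (by linarith [(hΦ _ hxr hxc).2.1]) _
  · intro x hx
    have h0 : α 0 = 0 := by
      simp only [α, Set.Icc.coe_zero, mul_zero]
      exact Set.projIcc_of_le_left _ le_rfl
    simp only [Γ, hβ0 0 (by norm_num), mul_zero, moveBlocks_zero, h0]
    rw [(hΦ _ (hUA x hx).1 (hUA x hx).2).1]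
  · refine hκA _ (fun j => hy'R _) ?_
    rw [hκiter, length_iter]
    exact mul_lt_mul_of_pos_left hy' hmpos
  · intro x hx
    have h1 : (β 1 : ℝ) = 1 := by
      have : (1 : ℝ) ≤ 2 * ((1 : I) : ℝ) - 1 := by norm_num
      simp only [β, Set.projIcc_of_right_le zero_le_one this]
    simp only [Γ, h1, mul_one, moveBlocks_last]

end Billiard

end

theorem propositionp (N : ℕ) (hN : 1 ≤ N) (S : Set (EuclideanSpace ℝ (Fin (N + 1))))
    (hS : Billiard.IsStrictlyConvexHypersurface S)
    (n : ℕ) [NeZero n] (q : ZMod n → EuclideanSpace ℝ (Fin (N + 1)))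
    (hq : Billiard.IsIsolatedCritical S q)
    (hmax : ¬ IsLocalMaxOn Billiard.length (Billiard.conf S n) q)
    (b : ℝ) (hb : b < Billiard.length q)
    (ε₀ : ℝ) (hε₀ : 0 < ε₀) (hε₀q : ε₀ ^ n < Billiard.gapProd q)
    (p : ℕ) (hp : 2 ≤ p) :
    ∃ (m : ℕ) (_ : NeZero m), (∃ k : ℕ, m = p ^ k) ∧
      ∀ (ε : ℝ) (hε : 0 < ε) (hle : ε ≤ ε₀) (j : ℕ),
        Billiard.iterHomologyMap S hε (Billiard.mem_confEps_of_le hq.1.1 hε hle hε₀q) hb m j = 0 := by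
  obtain ⟨C⟩ := Billiard.nonempty_confChart hS hq.1.1.1
  exact Billiard.exists_iterHomologyMap_eq_zero_of_confChart C hq hmax b hb ε₀ hε₀q p hp
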